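/- Let $1\le m\le n-1$ be integers and let $d_0,\dots,d_m$ be positive integers. Let $\Delta=\{x\in\mathbb R^{m+1}: x_i\ge 0,\ \sum_{i=0}^m x_i=1\}$, let $\mathrm{Int}\,\Delta=\{x\in\Delta: x_i>0\ \forall i\}$, let $dx=dx_1\cdots dx_m$ be Lebesgue measure on $\Delta$, and let $\mu_0$ be its normalisation to a probability measure. For $k=0,\dots,m$ let $$\Delta^\vee_k=\Big\{p\in\mathbb R^{m+1}: p_i\le 0\ \forall i,\ \sum_i d_ip_i\ge -1,\ p_k=0\Big\},\qquad \Delta^\vee=\bigcup_k\Delta^\vee_k,$$ and let $\bar\Delta^\vee_k,\bar\Delta^\vee$ be the images of $\Delta^\vee_k,\Delta^\vee$ in $\mathbb R^{m+1}/\mathbb R(1,\dots,1)$. The quotient map is a bijection from $\Delta^\vee$ to $\bar\Delta^\vee$, by which the two are identified; interiors and boundaries of the cells $\bar\Delta^\vee_k$ are taken in the quotient space. Let $W(p)=(1+\sum_i d_ip_i)^{n-m}$, let $dp$ be the measure on $\Delta^\vee$ which on each $\Delta^\vee_j$ is Lebesgue measure in the coordinates $(p_i)_{i\ne j}$, and put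 $C_1=\int_{\Delta^\vee}W\,dp$. For $u:\Delta\to\mathbb R$ and $x\in\Delta$ let $$\nabla u(x)=\{p\in\Delta^\vee\simeq\bar\Delta^\vee: u(x')\ge u(x)+\langle x'-x,p\rangle\ \text{ for all } x'\in\Delta\}.$$ Use the coordinates $(x_1,\dots,x_m)$ on the hyperplane $\sum x_i=1$ and the dual coordinates $(p_i-p_0)_{1\le i\le m}$ on $\mathbb R^{m+1}/\mathbb R(1,\dots,1)$ to identify both spaces with $\mathbb R^m$. Let $T$ be an optimal transport map, for the cost $\tfrac12|x-p|^2$ on $\mathbb R^m$, from the measure $C_1\mu_0$ on $\Delta$ to the measure $W\,dp$ on $\bar\Delta^\vee\simeq\Delta^\vee$, and let $u:\Delta\to\mathbb R$ be a continuous convex function such that $\nabla u(x)=\{T(x)\}$ for $\mu_0$-almost every $x$. Then: 1. The set $E$ of all $x\in\Delta$ such that some $p\in\nabla u(x)$ lies in $\bigcup_k\partial\bar\Delta^\vee_k$ is closed and has zero Lebesgue measure. 2. For each $k$ the chamber $\Delta_k=\{x\in\mathrm{Int}\,\Delta:\nabla u(x)\subset\mathrm{Int}\,\bar\Delta^\vee_k\}$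 is open (in the hyperplane $\sum x_i=1$), and $\bigcup_k\Delta_k$ has full Lebesgue measure in $\Delta$. 3. On each chamber $\Delta_k$ the function $u$ solves $$\det(D^2u)\,W(\nabla u)=\frac{C_1}{\int_\Delta dx}=\frac{d_0+\dots+d_m}{d_0\cdots d_m}\cdot\frac{(n-m)!\,m!}{n!}$$ in the following two senses. Weakly: $\int_{\nabla u(E')}W\,dp=\frac{C_1}{\int_\Delta dx}\int_{E'}dx$ for every Borel set $E'\subset\Delta_k$, where $\nabla u(E')=\bigcup_{x\in E'}\nabla u(x)$. Pointwise: for almost every $x\in\Delta_k$ the set $\nabla u(x)$ consists of a single point, $u$ has a second order Taylor expansion at $x$ in the coordinates $(x_1,\dots,x_m)$ (Alexandrov), with gradient $\nabla u(x)$ and symmetric Hessian $D^2u(x)$, and the equation holds at $x$. -/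

import Mathlib

open MeasureTheory Set Filter Topology Asymptotics
open scoped Matrix ENNReal

namespace WallChamber

noncomputable section

/-- The simplex `Δ = {x ∈ ℝ^{m+1} : x_i ≥ 0, ∑ x_i = 1}`. -/
abbrev simplex (m : ℕ) : Set (Fin (m + 1) → ℝ) := stdSimplex ℝ (Fin (m + 1))

/-- `Int Δ`, the interior of `Δ` in the hyperplane `∑ x_i = 1`. -/
def openSimplex (m : ℕ) : Set (Fin (m + 1) → ℝ) := {x | (∀ i, 0 < x i) ∧ ∑ i, x i = 1}

/-- The affine hyperplane `∑ x_i = 1`, with its subspace topology. -/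
abbrev Hyperplane (m : ℕ) : Type := {x : Fin (m + 1) → ℝ // ∑ i, x i = 1}

/-- The parametrisation of the hyperplane `∑ x_i = 1` by the coordinates `(x_1, …, x_m)`. -/
def param {m : ℕ} (y : Fin m → ℝ) : Fin (m + 1) → ℝ := Fin.cons (1 - ∑ i, y i) y

/-- Lebesgue measure `dx = dx_1 ⋯ dx_m` on `Δ` (total mass `1 / m!`). -/
def simplexVol (m : ℕ) : Measure (Fin (m + 1) → ℝ) :=
  ((volume : Measure (Fin m → ℝ)).map param).restrict (simplex m)

/-- `μ_0`: Lebesgue measure on `Δ`, normalised to be a probability measure. -/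
def normalizedVol (m : ℕ) : Measure (Fin (m + 1) → ℝ) :=
  (simplexVol m univ)⁻¹ • simplexVol m

/-- The dual cell `Δ^∨_k = {p : p_i ≤ 0, ∑ d_i p_i ≥ -1, p_k = 0}`. -/
def dualCell {m : ℕ} (d : Fin (m + 1) → ℕ) (k : Fin (m + 1)) : Set (Fin (m + 1) → ℝ) :=
  {p | (∀ i, p i ≤ 0) ∧ -1 ≤ ∑ i, (d i : ℝ) * p i ∧ p k = 0}

/-- The simplicial complex `Δ^∨ = ⋃_k Δ^∨_k`. -/
def dualComplex {m : ℕ} (d : Fin (m + 1) → ℕ) : Set (Fin (m + 1) → ℝ) :=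
  ⋃ k, dualCell d k

/-- The quotient space `ℝ^{m+1} / ℝ(1, …, 1)`, with its quotient topology. -/
abbrev Quot1 (m : ℕ) : Type :=
  (Fin (m + 1) → ℝ) ⧸ (Submodule.span ℝ {(1 : Fin (m + 1) → ℝ)})

/-- The quotient map `ℝ^{m+1} → ℝ^{m+1} / ℝ(1, …, 1)`. -/
def proj {m : ℕ} (p : Fin (m + 1) → ℝ) : Quot1 m := Submodule.Quotient.mk p

/-- The image cell in `ℝ^{m+1} / ℝ(1, …, 1)`. -/
def dualCellBar {m : ℕ} (d : Fin (m + 1) → ℕ) (k : Fin (m + 1)) : Set (Quot1 m) :=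
  proj '' dualCell d k

/-- The measure `dp` on `Δ^∨`: on each `Δ^∨_j` it is Lebesgue measure in the coordinates
`(p_i)_{i ≠ j}`. -/
def dualVol {m : ℕ} (d : Fin (m + 1) → ℕ) : Measure (Fin (m + 1) → ℝ) :=
  ∑ j : Fin (m + 1),
    ((volume : Measure (Fin m → ℝ)).map
      (fun q => (j.insertNth (0 : ℝ) q : Fin (m + 1) → ℝ))).restrict (dualCell d j)

/-- The weight `W(p) = (1 + ∑ d_i p_i)^{n-m}`. -/
def weight {m : ℕ} (d : Fin (m + 1) → ℕ) (n : ℕ) (p : Fin (m + 1) → ℝ) : ℝ :=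
  (1 + ∑ i, (d i : ℝ) * p i) ^ (n - m)

/-- The measure `W(p) dp` on `Δ^∨`. -/
def weightedDualVol {m : ℕ} (d : Fin (m + 1) → ℕ) (n : ℕ) : Measure (Fin (m + 1) → ℝ) :=
  (dualVol d).withDensity (fun p => ENNReal.ofReal (weight d n p))

/-- `C_1 = ∫_{Δ^∨} W dp`. -/
def constC1 {m : ℕ} (d : Fin (m + 1) → ℕ) (n : ℕ) : ℝ := ∫ p, weight d n p ∂(dualVol d)

/-- The set `∇u(x) ⊂ Δ^∨` of subgradients of `u : Δ → ℝ` at `x`. Each class of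
`ℝ^{m+1} / ℝ(1, …, 1)` meets `Δ^∨` at most once, and adding a multiple of `(1, …, 1)` to `p`
does not affect the inequality. Values of `u` outside `Δ` play no role. -/
def subgrad {m : ℕ} (d : Fin (m + 1) → ℕ) (u : (Fin (m + 1) → ℝ) → ℝ)
    (x : Fin (m + 1) → ℝ) : Set (Fin (m + 1) → ℝ) :=
  {p | p ∈ dualComplex d ∧ ∀ x' ∈ simplex m, u x + (x' - x) ⬝ᵥ p ≤ u x'}

/-- The set function `Mu(E) = ∫_{∇u(E)} W dp`. -/
def realMA {m : ℕ} (d : Fin (m + 1) → ℕ) (n : ℕ) (u : (Fin (m + 1) → ℝ) → ℝ)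
    (E : Set (Fin (m + 1) → ℝ)) : ℝ≥0∞ :=
  weightedDualVol d n (⋃ x ∈ E, subgrad d u x)

/-- `T` solves the Monge optimal transport problem from `μ` to `ν` for the cost `c ≥ 0`. -/
structure IsOptimalTransportMap {X Y : Type*} [MeasurableSpace X] [MeasurableSpace Y]
    (c : X → Y → ℝ) (μ : Measure X) (ν : Measure Y) (T : X → Y) : Prop where
  measurable : Measurable T
  map_eq : μ.map T = ν
  le_cost : ∀ S : X → Y, Measurable S → μ.map S = ν →
    ∫⁻ x, ENNReal.ofReal (c x (T x)) ∂μ ≤ ∫⁻ x, ENNReal.ofReal (c x (S x)) ∂μ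

/-- The gradient coordinates `(p_i - p_0)_{i = 1, …, m}` on `ℝ^{m+1} / ℝ(1, …, 1)`, dual to the
coordinates `(x_1, …, x_m)` on the hyperplane `∑ x_i = 1`. -/
def gradCoord {m : ℕ} (p : Fin (m + 1) → ℝ) : Fin m → ℝ := fun i => p i.succ - p 0

/-- The cost `|x - p|^2 / 2` on `ℝ^m`, where the hyperplane `∑ x_i = 1` and
`ℝ^{m+1} / ℝ(1, …, 1)` are identified with `ℝ^m` through dual coordinates. -/
def cost {m : ℕ} (x p : Fin (m + 1) → ℝ) : ℝ :=
  (1 / 2) * ∑ i : Fin m, (x i.succ - gradCoord p i) ^ 2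

/-- `u : Δ → ℝ` is a (continuous, convex) Brenier potential of the optimal transport problem from
`C_1 μ_0` on `Δ` to `W dp` on `Δ^∨`: the optimal map is `T = ∇u` almost everywhere. -/
structure IsTransportPotential {m : ℕ} (d : Fin (m + 1) → ℕ) (n : ℕ)
    (u : (Fin (m + 1) → ℝ) → ℝ) : Prop where
  convexOn : ConvexOn ℝ (simplex m) u
  continuousOn : ContinuousOn u (simplex m)
  exists_map : ∃ T : (Fin (m + 1) → ℝ) → (Fin (m + 1) → ℝ),
    IsOptimalTransportMap cost (ENNReal.ofReal (constC1 d n) • normalizedVol m)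
      (weightedDualVol d n) T ∧
    ∀ᵐ x ∂(normalizedVol m), subgrad d u x = {T x}

/-- The set of points of `Δ` at which some subgradient lies on the boundary of some cell. -/
def wallSet {m : ℕ} (d : Fin (m + 1) → ℕ) (u : (Fin (m + 1) → ℝ) → ℝ) :
    Set (Fin (m + 1) → ℝ) :=
  {x | x ∈ simplex m ∧ ∃ p ∈ subgrad d u x, ∃ k, proj p ∈ frontier (dualCellBar d k)}

/-- The chamber `Δ_k`: points of `Int Δ` all of whose subgradients lie in the interior of the
`k`-th cell. -/
def chamber {m : ℕ} (d : Fin (m + 1) → ℕ) (u : (Fin (m + 1) → ℝ) → ℝ) (k : Fin (m + 1)) :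
    Set (Fin (m + 1) → ℝ) :=
  {x | x ∈ openSimplex m ∧ ∀ p ∈ subgrad d u x, proj p ∈ interior (dualCellBar d k)}

/-- In the coordinates `(x_1, …, x_m)` the function `u` is twice differentiable at `x` in the sense
of Alexandrov, with gradient `q` and (symmetric) Hessian `A`. -/
def HasAlexandrovHessian {m : ℕ} (u : (Fin (m + 1) → ℝ) → ℝ) (x : Fin (m + 1) → ℝ)
    (q : Fin m → ℝ) (A : Matrix (Fin m) (Fin m) ℝ) : Prop :=
  A.IsSymm ∧
    (fun h : Fin m → ℝ =>
      u (param (Fin.tail x + h)) - u x - q ⬝ᵥ h - (1 / 2) * (h ⬝ᵥ (A *ᵥ h)))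
      =o[𝓝 0] (fun h : Fin m → ℝ => ‖h‖ ^ 2)

end

end WallChamber

open WallChamber

/-! In the coordinates (x_1, …, x_m), with p replaced by (p_i - p_0), T pushes c = C_1 / vol(Δ)
times Lebesgue measure on Δ to a measure with density, and T(x) is the only subgradient at almost
every x. A measure with density does not charge the boundaries of the convex cells, so T(x) almost
surely avoids them: the walls are null and the chambers have full measure. Closedness of the wall
set and openness of the chambers follow from compactness of the graph {(x, p) : p ∈ ∇u(x)}.

Weak equation: the Legendre conjugate of u is Lipschitz, hence differentiable almost everywhere, and
its gradient R inverts the subdifferential off a null set (`exists_conjugate_gradient`). As R ∘ T =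
id almost everywhere, the W-mass of ∇u(E) is that of R⁻¹(E), which is c|E|
(`withDensity_iUnion_subdiff`).

Pointwise equation: following Minty, the graph of the subdifferential ∂v is parametrised by z = x +
p, with x = J z and p = z - J z for the 1-Lipschitz proximal map J = (1 + ∂v)⁻¹. The points z where
J has no invertible derivative have a null image under J, by Rademacher and Sard. Where B = DJ(z) is
invertible, v has at J z a second order expansion with Hessian B⁻¹ - 1 (`second_order_expansion`).
Changing variables by J and by z ↦ z - J z in the mass balance gives |det(1 - B)| W = c |det B|
(`ae_jacobian_eq`), that is det(B⁻¹ - 1) W = c.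

The constant is a sum of Dirichlet integrals over the cells (`lintegral_scaledSimplex`). -/

namespace WallChamber

/-! ### Convex analysis: the proximal map and second order expansions. -/

section ConvexAnalysis

open scoped RealInnerProductSpace

variable {E : Type*} [NormedAddCommGroup E] [InnerProductSpace ℝ E]

/-- The subgradients at `x` of a function `v` on a set `S`. -/
def subdiff (S : Set E) (v : E → ℝ) (x : E) : Set E :=
  {p | ∀ x' ∈ S, v x + ⟪x' - x, p⟫ ≤ v x'}

variable {S : Set E} {v : E → ℝ}

theorem subdiff_monotone {x x' p p' : E} (hx : x ∈ S) (hx' : x' ∈ S)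
    (hp : p ∈ subdiff S v x) (hp' : p' ∈ subdiff S v x') : 0 ≤ ⟪x - x', p - p'⟫ := by
  have h1 := hp x' hx'
  have h2 := hp' x hx
  have h3 : ⟪x' - x, p⟫ = -⟪x - x', p⟫ := by rw [← inner_neg_left, neg_sub]
  rw [inner_sub_right]
  linarith

/-- The proximal point of `z`: existence. -/
theorem exists_prox (hS : IsCompact S) (hne : S.Nonempty) (hv : ConvexOn ℝ S v)
    (hc : ContinuousOn v S) (z : E) : ∃ x ∈ S, z - x ∈ subdiff S v x := by
  obtain ⟨x, hx, hmin⟩ := hS.exists_isMinOn hne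
    (f := fun x => v x + ‖x - z‖ ^ 2 / 2) (by fun_prop)
  refine ⟨x, hx, fun x' hx' => ?_⟩
  -- Minimality is tested on the segment from x to x' and divided by t; the error term disappears as
  -- t → 0.
  have key : ∀ t : ℝ, t ∈ Ioo (0 : ℝ) 1 →
      v x + ⟪x' - x, z - x⟫ - t * (‖x' - x‖ ^ 2 / 2) ≤ v x' := by
    intro t ht
    have hmem : x + t • (x' - x) ∈ S :=
      hv.1.add_smul_sub_mem hx hx' ⟨ht.1.le, ht.2.le⟩
    have h1 : v x + ‖x - z‖ ^ 2 / 2 ≤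
        v (x + t • (x' - x)) + ‖x + t • (x' - x) - z‖ ^ 2 / 2 := hmin hmem
    have h2 : v (x + t • (x' - x)) ≤ (1 - t) * v x + t * v x' := by
      have := hv.2 hx hx' (sub_nonneg.2 ht.2.le) ht.1.le (by ring)
      rwa [show (1 - t) • x + t • x' = x + t • (x' - x) by module] at this
    have h3 : ‖x + t • (x' - x) - z‖ ^ 2 =
        ‖x - z‖ ^ 2 - 2 * t * ⟪x' - x, z - x⟫ + t ^ 2 * ‖x' - x‖ ^ 2 := by
      rw [show x + t • (x' - x) - z = t • (x' - x) - (z - x) by abel, norm_sub_sq_real,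
        norm_smul, mul_pow, real_inner_smul_left, norm_sub_rev x z, Real.norm_eq_abs, sq_abs]
      ring
    have h4 : t * (v x + ⟪x' - x, z - x⟫ - t * (‖x' - x‖ ^ 2 / 2)) ≤ t * v x' := by
      rw [h3] at h1
      nlinarith
    exact le_of_mul_le_mul_left h4 ht.1
  have hlim : Tendsto (fun t : ℝ => v x + ⟪x' - x, z - x⟫ - t * (‖x' - x‖ ^ 2 / 2)) (𝓝[>] 0)
      (𝓝 (v x + ⟪x' - x, z - x⟫ - 0 * (‖x' - x‖ ^ 2 / 2))) :=
    Tendsto.mono_left (Continuous.tendsto (by fun_prop) 0) nhdsWithin_le_nhds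
  rw [zero_mul, sub_zero] at hlim
  refine le_of_tendsto hlim ?_
  filter_upwards [Ioo_mem_nhdsGT (one_pos : (0 : ℝ) < 1)] with t ht using key t ht

/-- `J` is the proximal map (resolvent of the subdifferential) of `v` on `S`. -/
def IsProx (S : Set E) (v : E → ℝ) (J : E → E) : Prop :=
  ∀ z, J z ∈ S ∧ z - J z ∈ subdiff S v (J z)

theorem exists_isProx (hS : IsCompact S) (hne : S.Nonempty) (hv : ConvexOn ℝ S v)
    (hc : ContinuousOn v S) : ∃ J, IsProx S v J := by
  choose J h1 h2 using exists_prox hS hne hv hc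
  exact ⟨J, fun z => ⟨h1 z, h2 z⟩⟩

/-- The potential of the proximal map. -/
noncomputable def proxPotential (v : E → ℝ) (J : E → E) (z : E) : ℝ :=
  ⟪J z, z⟫ - v (J z) - ‖J z‖ ^ 2 / 2

namespace IsProx

variable {J : E → E} (hJ : IsProx S v J)
include hJ

/-- This is monotonicity of the subdifferential for the pairs (J z, z - J z). It is stronger than
the Lipschitz bound, and its infinitesimal form makes B⁻¹ - 1 nonnegative. -/
theorem firmlyNonexpansive (z z' : E) : ‖J z - J z'‖ ^ 2 ≤ ⟪J z - J z', z - z'⟫ := by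
  have := subdiff_monotone (hJ z).1 (hJ z').1 (hJ z).2 (hJ z').2
  rw [show z - J z - (z' - J z') = (z - z') - (J z - J z') by abel, inner_sub_right,
    real_inner_self_eq_norm_sq] at this
  linarith

theorem norm_sub_le (z z' : E) : ‖J z - J z'‖ ≤ ‖z - z'‖ := by
  have h1 := hJ.firmlyNonexpansive z z'
  have h2 := real_inner_le_norm (J z - J z') (z - z')
  by_contra! h
  nlinarith [norm_nonneg (z - z')]

theorem lipschitz : LipschitzWith 1 J :=
  LipschitzWith.of_dist_le_mul fun z z' => by simpa [dist_eq_norm] using hJ.norm_sub_le z z'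

/-- Together with `IsProx`, this makes z ↦ (J z, z - J z) a bijection onto the graph of the
subdifferential over S. -/
theorem apply_add {x p : E} (hx : x ∈ S) (hp : p ∈ subdiff S v x) : J (x + p) = x := by
  have h := subdiff_monotone (hJ (x + p)).1 hx (hJ (x + p)).2 hp
  rw [show x + p - J (x + p) - p = -(J (x + p) - x) by abel, inner_neg_right,
    real_inner_self_eq_norm_sq] at h
  have : ‖J (x + p) - x‖ = 0 := by nlinarith [sq_nonneg ‖J (x + p) - x‖]
  exact sub_eq_zero.1 (norm_eq_zero.1 this)

/-- Fenchel–Young inequality. -/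
theorem le_proxPotential {x : E} (hx : x ∈ S) (z : E) :
    ⟪x, z⟫ - v x - ‖x‖ ^ 2 / 2 ≤ proxPotential v J z := by
  have h := (hJ z).2 x hx
  have h2 : 0 ≤ ‖x - J z‖ ^ 2 := sq_nonneg _
  rw [norm_sub_sq_real] at h2
  simp only [inner_sub_left, inner_sub_right, real_inner_self_eq_norm_sq] at h
  simp only [proxPotential]
  linarith

/-- `proxPotential` is the conjugate of v + ‖·‖²/2. Fenchel–Young used in both directions leaves the
gap ⟪J z' - J z, z' - z⟫, which is quadratic because J is nonexpansive; hence J is its gradient. -/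
theorem proxPotential_bounds (z z' : E) :
    proxPotential v J z + ⟪J z, z' - z⟫ ≤ proxPotential v J z' ∧
    proxPotential v J z' ≤ proxPotential v J z + ⟪J z, z' - z⟫ + ‖z' - z‖ ^ 2 := by
  have h1 := hJ.le_proxPotential (hJ z).1 z'
  have h2 := hJ.le_proxPotential (hJ z').1 z
  have h3 := real_inner_le_norm (J z' - J z) (z' - z)
  have h4 := hJ.norm_sub_le z' z
  simp only [proxPotential, inner_sub_left, inner_sub_right] at *
  constructor
  · linarith
  · nlinarith [norm_nonneg (z' - z)]

theorem hasFDerivAt_proxPotential (z : E) :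
    HasFDerivAt (proxPotential v J) (innerSL ℝ (J z)) z := by
  rw [hasFDerivAt_iff_isLittleO_nhds_zero]
  refine IsBigO.trans_isLittleO (g := fun h : E => ‖h‖ ^ 2) ?_ ?_
  · refine IsBigO.of_bound 1 (Eventually.of_forall fun h => ?_)
    obtain ⟨h1, h2⟩ := hJ.proxPotential_bounds z (z + h)
    rw [add_sub_cancel_left] at h1 h2
    rw [innerSL_apply_apply, one_mul, Real.norm_eq_abs, Real.norm_of_nonneg (by positivity), abs_le]
    constructor <;> nlinarith [sq_nonneg ‖h‖]
  · simpa using isLittleO_norm_pow_id (E' := E) one_lt_two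

variable {B : E →L[ℝ] E} {z : E} (hB : HasFDerivAt J B z)
include hB

/-- B is the second derivative of `proxPotential`. Symmetry needs only that the gradient J exists
everywhere and is differentiable at z. -/
theorem deriv_symm (w w' : E) : ⟪B w, w'⟫ = ⟪w, B w'⟫ := by
  have h : HasFDerivAt (fun z => innerSL ℝ (J z)) ((innerSL ℝ).comp B) z :=
    (innerSL ℝ (E := E)).hasFDerivAt.comp z hB
  have := second_derivative_symmetric (fun y => hJ.hasFDerivAt_proxPotential y) h w w'
  simp only [ContinuousLinearMap.comp_apply, innerSL_apply_apply] at this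
  rw [this, real_inner_comm]

theorem norm_sq_deriv_le (w : E) : ‖B w‖ ^ 2 ≤ ⟪B w, w⟫ := by
  have hd : Tendsto (fun t : ℝ => t⁻¹ • (J (z + t • w) - J z)) (𝓝[≠] 0) (𝓝 (B w)) :=
    (hB.hasLineDerivAt w).tendsto_slope_zero
  have h1 := hd.norm.pow 2
  have h2 : Tendsto (fun t : ℝ => ⟪t⁻¹ • (J (z + t • w) - J z), w⟫) (𝓝[≠] 0) (𝓝 ⟪B w, w⟫) :=
    hd.inner tendsto_const_nhds
  refine le_of_tendsto_of_tendsto h1 h2 ?_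
  filter_upwards [self_mem_nhdsWithin] with t ht
  have h3 := hJ.firmlyNonexpansive (z + t • w) z
  rw [add_sub_cancel_left, real_inner_smul_right] at h3
  rw [norm_smul, mul_pow, real_inner_smul_left, Real.norm_eq_abs, sq_abs]
  have ht' : t ≠ 0 := ht
  calc t⁻¹ ^ 2 * ‖J (z + t • w) - J z‖ ^ 2 ≤ t⁻¹ ^ 2 * (t * ⟪J (z + t • w) - J z, w⟫) := by gcongr
    _ = _ := by field_simp

/-- Second order Taylor expansion of the potential. -/
theorem taylor_proxPotential :
    (fun w => proxPotential v J (z + w) - proxPotential v J z - ⟪J z, w⟫ - ⟪B w, w⟫ / 2)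
      =o[𝓝 0] fun w => ‖w‖ ^ 2 := by
  set g : E → ℝ := fun w =>
    proxPotential v J (z + w) - proxPotential v J z - ⟪J z, w⟫ - ⟪B w, w⟫ / 2 with hg
  have hg' : ∀ w, HasFDerivAt g (innerSL ℝ (J (z + w) - J z - B w)) w := by
    intro w
    have h1 : HasFDerivAt (fun w => proxPotential v J (z + w)) (innerSL ℝ (J (z + w))) w :=
      (hasFDerivAt_comp_add_left z).2 (hJ.hasFDerivAt_proxPotential (z + w))
    have h2 : HasFDerivAt (fun w => ⟪J z, w⟫) (innerSL ℝ (J z)) w :=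
      (innerSL ℝ (J z)).hasFDerivAt
    have h3 := (B.hasFDerivAt (x := w)).inner ℝ (hasFDerivAt_id w)
    have h4 := ((h1.sub_const (proxPotential v J z)).sub h2).sub (h3.mul_const (1 / 2))
    refine (h4.congr_of_eventuallyEq (Eventually.of_forall fun y => ?_)).congr_fderiv ?_
    · simp only [hg, Pi.sub_apply, id]
      ring
    · ext y
      have := hJ.deriv_symm hB w y
      simp [fderivInnerCLM_apply, real_inner_comm] at this ⊢
      linarith
  rw [hasFDerivAt_iff_isLittleO_nhds_zero, isLittleO_iff] at hB
  rw [isLittleO_iff]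
  intro ε hε
  obtain ⟨δ, hδ, hball⟩ := Metric.eventually_nhds_iff_ball.1 (hB hε)
  filter_upwards [Metric.ball_mem_nhds 0 hδ] with w hw
  have hsub : Metric.closedBall (0 : E) ‖w‖ ⊆ Metric.ball 0 δ :=
    Metric.closedBall_subset_ball (by simpa using hw)
  -- The gradient of the remainder is the first order error of J, at most ε‖w‖ on the ball of radius
  -- ‖w‖; the mean value inequality supplies the second factor ‖w‖.
  have := (convex_closedBall (0 : E) ‖w‖).norm_image_sub_le_of_norm_hasFDerivWithin_le
    (f := g) (C := ε * ‖w‖) (x := 0) (y := w) (fun y _ => (hg' y).hasFDerivWithinAt)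
    (fun y hy => by
      rw [innerSL_apply_norm]
      refine (hball y (hsub hy)).trans ?_
      gcongr
      simpa using hy)
    (by simp) (by simp)
  have h0 : g 0 = 0 := by simp [hg]
  rw [h0, sub_zero, sub_zero] at this
  rwa [norm_pow, norm_norm, pow_two, ← mul_assoc]

end IsProx

namespace IsProx

variable {J : E → E} (hJ : IsProx S v J) {B : E ≃L[ℝ] E} {z : E}
  (hB : HasFDerivAt J (B : E →L[ℝ] E) z)
include hJ hB

/-- Combines ‖B w‖² ≤ ⟪B w, w⟫ with ‖w‖ ≤ M ‖B w‖. The summand 1 in M keeps it positive even when E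
is trivial. -/
theorem deriv_coercive : ∃ β > 0, ∀ w, β * ‖w‖ ^ 2 ≤ ⟪B w, w⟫ := by
  set M : ℝ := ‖(B.symm : E →L[ℝ] E)‖ + 1
  have hM : 0 < M := by positivity
  refine ⟨(M ^ 2)⁻¹, by positivity, fun w => ?_⟩
  have h1 : ‖w‖ ≤ M * ‖B w‖ := by
    have := (B.symm : E →L[ℝ] E).le_opNorm (B w)
    simp only [ContinuousLinearEquiv.coe_coe, ContinuousLinearEquiv.symm_apply_apply] at this
    refine this.trans ?_
    gcongr
    simp [M]
  refine le_trans ?_ (hJ.norm_sq_deriv_le hB w)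
  calc (M ^ 2)⁻¹ * ‖w‖ ^ 2 ≤ (M ^ 2)⁻¹ * (M * ‖B w‖) ^ 2 := by gcongr
    _ = ‖B w‖ ^ 2 := by field_simp

/-- At a point of invertible differentiability the proximal map is expansive, globally in `w`. -/
theorem expansive : ∃ β > 0, ∃ ρ > 0, ∀ w,
    ‖J (z + w) - J z‖ < ρ → β * ‖w‖ ≤ ‖J (z + w) - J z‖ := by
  obtain ⟨β, hβ, hco⟩ := hJ.deriv_coercive hB
  have hlo := hasFDerivAt_iff_isLittleO_nhds_zero.1 hB
  rw [isLittleO_iff] at hlo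
  obtain ⟨δ, hδ, hball⟩ := Metric.eventually_nhds_iff_ball.1 (hlo (half_pos hβ))
  have near : ∀ w, ‖w‖ < δ → β / 2 * ‖w‖ ^ 2 ≤ ⟪J (z + w) - J z, w⟫ := by
    intro w hw
    have h1 := hball w (by simpa using hw)
    have h2 := hco w
    have h3 := (abs_le.1 (abs_real_inner_le_norm (J (z + w) - J z - B w) w)).1
    rw [inner_sub_left (J (z + w) - J z) (B w) w] at h3
    simp only [ContinuousLinearEquiv.coe_coe] at h1
    nlinarith [norm_nonneg w]
  refine ⟨β / 2, by positivity, β / 2 * (δ / 2), by positivity, fun w hw => ?_⟩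
  have h5 := real_inner_le_norm (J (z + w) - J z) w
  rcases eq_or_ne w 0 with rfl | hw0
  · simp
  have hwpos : 0 < ‖w‖ := norm_pos_iff.2 hw0
  rcases lt_or_ge ‖w‖ δ with h | h
  · have h6 := near w h
    exact le_of_mul_le_mul_right (by nlinarith) hwpos
  · exfalso
    -- A far point is compared with the point at distance δ/2 on the same ray. Monotonicity of J
    -- along the ray carries the near estimate outwards, so J z moves by at least ρ, a
    -- contradiction.
    set t : ℝ := δ / 2 / ‖w‖ with ht
    have htw : t * ‖w‖ = δ / 2 := by rw [ht]; field_simp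
    have ht0 : 0 < t := by positivity
    have ht1 : t < 1 := by rw [ht, div_lt_one hwpos]; linarith
    have h6 := near (t • w) (by rw [norm_smul, Real.norm_of_nonneg ht0.le, htw]; linarith)
    rw [norm_smul, Real.norm_of_nonneg ht0.le, htw, real_inner_smul_right] at h6
    have h7 := (sq_nonneg _).trans (hJ.firmlyNonexpansive (z + w) (z + t • w))
    rw [show z + w - (z + t • w) = (1 - t) • w by module, real_inner_smul_right] at h7
    have h8 : 0 ≤ ⟪J (z + w) - J (z + t • w), w⟫ :=
      nonneg_of_mul_nonneg_right h7 (by linarith)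
    have h9 : ⟪J (z + w) - J z, w⟫ = ⟪J (z + w) - J (z + t • w), w⟫ + ⟪J (z + t • w) - J z, w⟫ := by
      rw [← inner_add_left]; congr 1; abel
    have h10 : t * (β / 2 * (δ / 2) * ‖w‖) ≤ t * ⟪J (z + t • w) - J z, w⟫ := by
      calc _ = β / 2 * (δ / 2) * (t * ‖w‖) := by ring
        _ ≤ _ := by rw [htw]; linarith
    have h11 := le_of_mul_le_mul_left h10 ht0
    nlinarith

/-- Through `apply_add` this says that J z has the single subgradient z - J z; it also makes J
injective on its regular set. -/
theorem eq_of_apply_eq {z' : E} (h : J z' = J z) : z' = z := by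
  obtain ⟨β, hβ, ρ, hρ, H⟩ := hJ.expansive hB
  have := H (z' - z) (by simpa [h] using hρ)
  rw [add_sub_cancel, h, sub_self, norm_zero] at this
  have h2 : ‖z' - z‖ ≤ 0 := by by_contra! h3; nlinarith [mul_pos hβ h3]
  exact sub_eq_zero.1 (norm_le_zero_iff.1 h2)

/-- Alexandrov expansion of a convex function at the image of a point where the proximal map has
an invertible derivative. -/
theorem second_order_expansion
    (hU : ∀ᶠ h in 𝓝 (0 : E), J z + h ∈ S ∧ (subdiff S v (J z + h)).Nonempty) :
    (fun h => v (J z + h) - v (J z) - ⟪z - J z, h⟫ - ⟪B.symm h - h, h⟫ / 2)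
      =o[𝓝 0] fun h => ‖h‖ ^ 2 := by
  obtain ⟨β, hβ, ρ, hρ, hexp⟩ := hJ.expansive hB
  -- One constant bounding both increments used below, B⁻¹h and the w obtained from a subgradient at
  -- J z + h.
  set K : ℝ := ‖(B.symm : E →L[ℝ] E)‖ + 1 / β with hK
  have hK0 : 0 < K := by positivity
  rw [isLittleO_iff]
  intro ε hε
  have hT := hJ.taylor_proxPotential hB
  rw [isLittleO_iff] at hT
  obtain ⟨δ, hδ, hball⟩ := Metric.eventually_nhds_iff_ball.1 (hT (c := ε / K ^ 2) (by positivity))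
  have hpot : proxPotential v J z = ⟪J z, z⟫ - v (J z) - ‖J z‖ ^ 2 / 2 := rfl
  filter_upwards [hU, Metric.ball_mem_nhds 0 hρ, Metric.ball_mem_nhds 0 (div_pos hδ hK0)]
    with h ⟨hS, p, hp⟩ hhρ hhδ
  rw [mem_ball_zero_iff] at hhρ hhδ
  have small : ∀ w : E, ‖w‖ ≤ K * ‖h‖ →
      |proxPotential v J (z + w) - proxPotential v J z - ⟪J z, w⟫ - ⟪B w, w⟫ / 2|
        ≤ ε * ‖h‖ ^ 2 := by
    intro w hw
    have h1 : ‖w‖ < δ := hw.trans_lt (by rwa [lt_div_iff₀ hK0, mul_comm] at hhδ)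
    refine (hball w (by simpa using h1)).trans ?_
    rw [norm_pow, norm_norm]
    calc ε / K ^ 2 * ‖w‖ ^ 2 ≤ ε / K ^ 2 * (K * ‖h‖) ^ 2 := by gcongr
      _ = ε * ‖h‖ ^ 2 := by field_simp
  have hexpand : ‖J z + h‖ ^ 2 = ‖J z‖ ^ 2 + 2 * ⟪J z, h⟫ + ‖h‖ ^ 2 := norm_add_sq_real _ _
  rw [norm_pow, norm_norm, Real.norm_eq_abs, abs_le]
  constructor
  -- Lower bound on v(J z + h): Fenchel–Young at z + B⁻¹h, the optimal point to second order.
  · have hw : ‖B.symm h‖ ≤ K * ‖h‖ := by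
      refine ((B.symm : E →L[ℝ] E).le_opNorm h).trans ?_
      gcongr
      rw [hK]
      have : 0 < 1 / β := by positivity
      linarith
    have h1 := (abs_le.1 (small _ hw)).2
    have h2 := hJ.le_proxPotential hS (z + B.symm h)
    rw [B.apply_symm_apply] at h1
    rw [hpot] at h1
    simp only [inner_add_left, inner_add_right, inner_sub_left, real_inner_self_eq_norm_sq] at *
    rw [real_inner_comm h z, real_inner_comm h (B.symm h)]
    linarith
  -- Upper bound: a subgradient p at J z + h gives equality in Fenchel–Young at z + w. Then ⟪w, h⟫ -
  -- ⟪B w, w⟫/2 ≤ ⟪B⁻¹h, h⟫/2, since B is nonnegative on w - B⁻¹h.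
  · have hz' := hJ.apply_add hS hp
    set w : E := J z + h + p - z with hwdef
    have hzw : z + w = J z + h + p := by rw [hwdef]; abel
    have hJw : J (z + w) = J z + h := by rw [hzw, hz']
    have h0 := hexp w (by rw [hJw, add_sub_cancel_left]; exact hhρ)
    rw [hJw, add_sub_cancel_left] at h0
    have hw : ‖w‖ ≤ K * ‖h‖ := by
      have : ‖w‖ ≤ 1 / β * ‖h‖ := by
        rw [one_div, ← div_eq_inv_mul, le_div_iff₀ hβ, mul_comm]; exact h0
      refine this.trans ?_
      gcongr
      rw [hK]
      linarith [norm_nonneg (B.symm : E →L[ℝ] E)]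
    have h1 := (abs_le.1 (small w hw)).1
    have h2 : proxPotential v J (z + w) =
      ⟪J z + h, z + w⟫ - v (J z + h) - ‖J z + h‖ ^ 2 / 2 := by rw [proxPotential, hJw]
    have h3 : 0 ≤ ⟪B (w - B.symm h), w - B.symm h⟫ :=
      (sq_nonneg _).trans (hJ.norm_sq_deriv_le hB (w - B.symm h))
    have h4 : ⟪B w, B.symm h⟫ = ⟪w, h⟫ := by
      have := hJ.deriv_symm hB w (B.symm h)
      simpa using this
    rw [h2, hpot] at h1
    rw [map_sub, B.apply_symm_apply] at h3
    simp only [inner_add_left, inner_add_right, inner_sub_left, inner_sub_right,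
      real_inner_self_eq_norm_sq] at *
    rw [real_inner_comm h z, real_inner_comm h (B.symm h)]
    rw [real_inner_comm h w] at h4
    linarith

end IsProx
end ConvexAnalysis

/-! ### Measure theory of subgradient transport: weak and Jacobian equations. -/

section MeasureTheoretic

open scoped RealInnerProductSpace

variable {E : Type*} [NormedAddCommGroup E] [InnerProductSpace ℝ E] [FiniteDimensional ℝ E]
  [MeasurableSpace E] [BorelSpace E] {μ : Measure E} [μ.IsAddHaarMeasure]
  {S : Set E} {v : E → ℝ}

/-- Haar measure has the same null sets as the Hausdorff measure of full dimension, which a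
1-Lipschitz map does not increase. -/
theorem addHaar_image_eq_zero_of_lipschitz {f : E → E} (hf : LipschitzWith 1 f) {s : Set E}
    (hs : μ s = 0) : μ (f '' s) = 0 := by
  have h0 : μH[Module.finrank ℝ E] s = 0 :=
    Measure.absolutelyContinuous_isAddHaarMeasure _ μ hs
  have h1 := hf.hausdorffMeasure_image_le (d := Module.finrank ℝ E) (by positivity) s
  rw [h0, mul_zero] at h1
  exact Measure.absolutelyContinuous_isAddHaarMeasure μ μH[Module.finrank ℝ E]
    (nonpos_iff_eq_zero.1 h1)

/-- The points where a map has an invertible derivative. -/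
def regularSet (J : E → E) : Set E := {z | DifferentiableAt ℝ J z ∧ (fderiv ℝ J z).det ≠ 0}

omit [FiniteDimensional ℝ E] in
theorem measurable_det_fderiv [CompleteSpace E] (J : E → E) :
    Measurable fun z => (fderiv ℝ J z).det :=
  ContinuousLinearMap.continuous_det.measurable.comp (measurable_fderiv ℝ J)

theorem measurableSet_regularSet (J : E → E) : MeasurableSet (regularSet J) :=
  (measurableSet_of_differentiableAt ℝ J).inter
    ((measurable_det_fderiv J) (measurableSet_singleton 0).compl)

/-- The nondifferentiability points are null by Rademacher, so their image is null; the critical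
points have null image by Sard. -/
theorem addHaar_image_compl_regularSet {J : E → E} (hJ : LipschitzWith 1 J) :
    μ (J '' (regularSet J)ᶜ) = 0 := by
  have : (regularSet J)ᶜ ⊆ {z | ¬ DifferentiableAt ℝ J z} ∪
      {z | DifferentiableAt ℝ J z ∧ (fderiv ℝ J z).det = 0} := by
    intro z hz
    simp only [regularSet, mem_compl_iff, mem_ofPred_eq, not_and, not_not] at hz
    by_cases h : DifferentiableAt ℝ J z
    · exact Or.inr ⟨h, hz h⟩
    · exact Or.inl h
  refine measure_mono_null (image_mono this) ?_
  rw [image_union, measure_union_null_iff]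
  exact ⟨addHaar_image_eq_zero_of_lipschitz hJ (ae_iff.1 hJ.ae_differentiableAt),
    addHaar_image_eq_zero_of_det_fderivWithin_eq_zero μ
      (fun z hz => hz.1.hasFDerivAt.hasFDerivWithinAt) fun z hz => hz.2⟩

/-- The gradient of the Legendre conjugate inverts the subdifferential almost everywhere. -/
theorem exists_conjugate_gradient (μ : Measure E) [μ.IsAddHaarMeasure]
    (hS : IsCompact S) (hne : S.Nonempty) (hc : ContinuousOn v S) :
    ∃ (N : Set E) (R : E → E), MeasurableSet N ∧ μ N = 0 ∧ Measurable R ∧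
      ∀ p ∉ N, R p ∈ S ∧ p ∈ subdiff S v (R p) ∧ ∀ x ∈ S, p ∈ subdiff S v x → x = R p := by
  have hex : ∀ p : E, ∃ x ∈ S, p ∈ subdiff S v x := by
    intro p
    obtain ⟨x, hx, hmax⟩ := hS.exists_isMaxOn hne (f := fun x => ⟪x, p⟫ - v x) (by fun_prop)
    refine ⟨x, hx, fun x' hx' => ?_⟩
    have : ⟪x', p⟫ - v x' ≤ ⟪x, p⟫ - v x := hmax hx'
    rw [inner_sub_left]
    linarith
  choose M hMS hM using hex
  -- g is the Legendre conjugate of v on S, Lipschitz because S is bounded.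
  set g : E → ℝ := fun p => ⟪M p, p⟫ - v (M p) with hg
  have hle : ∀ p, ∀ x ∈ S, ⟪x, p⟫ - v x ≤ g p := by
    intro p x hx
    have := hM p x hx
    rw [inner_sub_left] at this
    simp only [hg]
    linarith
  obtain ⟨C, hC⟩ := hS.isBounded.exists_norm_le
  have hlip : LipschitzWith (Real.toNNReal C) g := by
    refine LipschitzWith.of_le_add_mul _ fun p p' => ?_
    have h1 := hle p' (M p) (hMS p)
    have h2 := real_inner_le_norm (M p) (p - p')
    have h3 := mul_le_mul_of_nonneg_right ((hC _ (hMS p)).trans (Real.le_coe_toNNReal C))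
      (norm_nonneg (p - p'))
    rw [inner_sub_right] at h2
    rw [dist_eq_norm]
    simp only [hg] at *
    linarith
  have key : ∀ p, DifferentiableAt ℝ g p → ∀ x ∈ S, p ∈ subdiff S v x → x = gradient g p := by
    intro p hp x hx hpx
    have heq : g p = ⟪x, p⟫ - v x := by
      refine le_antisymm ?_ (hle p x hx)
      have := hpx (M p) (hMS p)
      rw [inner_sub_left] at this
      simp only [hg]
      linarith
    -- Equality in Fenchel–Young at (x, p) makes p a minimum of g - ⟪x, ·⟫, so x is forced to be the
    -- gradient of g at p.
    have hmin : IsLocalMin (fun q => g q - ⟪x, q⟫) p := Eventually.of_forall fun q => by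
      have := hle q x hx
      simp only [heq]
      linarith
    have hd : HasFDerivAt (fun q => g q - ⟪x, q⟫) (fderiv ℝ g p - innerSL ℝ x) p :=
      hp.hasFDerivAt.sub (innerSL ℝ x).hasFDerivAt
    have h0 := sub_eq_zero.1 (hmin.hasFDerivAt_eq_zero hd)
    rw [gradient, h0]
    exact ((InnerProductSpace.toDual ℝ E).symm_apply_apply x).symm
  refine ⟨{p | DifferentiableAt ℝ g p}ᶜ, gradient g, (measurableSet_of_differentiableAt ℝ g).compl,
    ae_iff.1 hlip.ae_differentiableAt,
    (InnerProductSpace.toDual ℝ E).symm.continuous.measurable.comp (measurable_fderiv ℝ g),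
    fun p hp => ?_⟩
  rw [mem_compl_iff, not_not] at hp
  have h1 := key p hp (M p) (hMS p) (hM p)
  exact ⟨h1 ▸ hMS p, h1 ▸ hM p, key p hp⟩

/-- `T` transports `c` times Haar measure on `S` to the measure of density `ω`, and `T x` is a
subgradient of `v` at almost every point `x` of `S`. -/
structure IsSubgradientTransport (μ : Measure E) (S : Set E) (v : E → ℝ) (ω : E → ℝ≥0∞)
    (c : ℝ≥0∞) (T : E → E) : Prop where
  isCompact : IsCompact S
  nonempty : S.Nonempty
  convexOn : ConvexOn ℝ S v
  continuousOn : ContinuousOn v S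
  c_ne_zero : c ≠ 0
  measurable_density : Measurable ω
  measurable : Measurable T
  map_eq : (c • μ.restrict S).map T = μ.withDensity ω
  ae_mem : ∀ᵐ x ∂μ.restrict S, T x ∈ subdiff S v x

namespace IsSubgradientTransport

variable {ω : E → ℝ≥0∞} {c : ℝ≥0∞} {T : E → E} (h : IsSubgradientTransport μ S v ω c T)
include h

omit [FiniteDimensional ℝ E] [BorelSpace E] [μ.IsAddHaarMeasure] in
theorem withDensity_apply {A : Set E} (hA : MeasurableSet A) :
    μ.withDensity ω A = c * μ.restrict S (T ⁻¹' A) := by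
  rw [← h.map_eq, Measure.map_apply h.measurable hA, Measure.smul_apply, smul_eq_mul]

omit [FiniteDimensional ℝ E] [BorelSpace E] [μ.IsAddHaarMeasure] in
theorem ae_notMem {N : Set E} (hN : MeasurableSet N) (h0 : μ N = 0) :
    ∀ᵐ x ∂μ.restrict S, T x ∉ N := by
  have h1 := h.withDensity_apply hN
  rw [withDensity_absolutelyContinuous μ ω h0, eq_comm, mul_eq_zero] at h1
  exact compl_mem_ae_iff.2 (h1.resolve_left h.c_ne_zero)

/-- The weak (Aleksandrov) form of the Monge–Ampère equation. -/
theorem withDensity_iUnion_subdiff {K : Set E} (hK : μ.withDensity ω Kᶜ = 0) {A : Set E}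
    (hA : MeasurableSet A) (hAS : A ⊆ S) :
    NullMeasurableSet (⋃ x ∈ A, subdiff S v x ∩ K) (μ.withDensity ω) ∧
      μ.withDensity ω (⋃ x ∈ A, subdiff S v x ∩ K) = c * μ A := by
  obtain ⟨N, R, hNm, hN0, hR, H⟩ :=
    exists_conjugate_gradient μ h.isCompact h.nonempty h.continuousOn
  have h1 : (⋃ x ∈ A, subdiff S v x ∩ K : Set E) =ᵐ[μ.withDensity ω] R ⁻¹' A := by
    refine eventuallyEq_set.2 ?_
    have hN' : μ.withDensity ω N = 0 := withDensity_absolutelyContinuous μ ω hN0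
    filter_upwards [compl_mem_ae_iff.2 hN', mem_ae_iff.2 hK] with p hp hpK
    obtain ⟨h2, h3, h4⟩ := H p hp
    refine ⟨fun hx => ?_, fun hx => ?_⟩
    · obtain ⟨x, hxA, hx, -⟩ := mem_iUnion₂.1 hx
      rw [h4 x (hAS hxA) hx] at hxA
      exact hxA
    · exact mem_iUnion₂.2 ⟨R p, hx, h3, hpK⟩
  refine ⟨((hR hA).nullMeasurableSet).congr h1.symm, ?_⟩
  rw [measure_congr h1, h.withDensity_apply (hR hA)]
  congr 1
  rw [← inter_eq_self_of_subset_left hAS, ← Measure.restrict_apply hA]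
  refine measure_congr (eventuallyEq_set.2 ?_)
  filter_upwards [h.ae_mem, h.ae_notMem hNm hN0, ae_restrict_mem h.isCompact.measurableSet]
    with x hx hxN hxS
  -- T x is a subgradient at x, and off N only R (T x) can have it as subgradient.
  have : R (T x) = x := ((H _ hxN).2.2 x hxS hx).symm
  rw [mem_preimage, mem_preimage, this]
  exact and_iff_left hxS

/-- The pointwise form of the Monge–Ampère equation, in terms of the proximal map. -/
theorem ae_jacobian_eq {J : E → E} (hJ : IsProx S v J) :
    ∀ᵐ x ∂μ.restrict S, ∃ z ∈ regularSet J, J z = x ∧ T x = z - x ∧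
      ENNReal.ofReal |(ContinuousLinearMap.id ℝ E - fderiv ℝ J z).det| * ω (z - x) =
        c * ENNReal.ofReal |(fderiv ℝ J z).det| := by
  obtain ⟨N, R, hNm, hN0, hR, H⟩ :=
    exists_conjugate_gradient μ h.isCompact h.nonempty h.continuousOn
  have hJc : Continuous J := hJ.lipschitz.continuous
  have hinj : ∀ z ∈ regularSet J, ∀ z', J z' = J z → z' = z := by
    intro z hz z' hz'
    have hB : HasFDerivAt J (((fderiv ℝ J z).toContinuousLinearEquivOfDetNeZero hz.2 : E ≃L[ℝ] E) :
        E →L[ℝ] E) z := by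
      simpa using hz.1.hasFDerivAt
    exact hJ.eq_of_apply_eq hB hz'
  set Q : E → E := fun z => z - J z with hQ
  have hQm : Measurable Q := by fun_prop
  -- On G both J and Q are injective: J by expansiveness at regular points, Q because R ∘ Q = J
  -- there.
  set G : Set E := regularSet J ∩ Q ⁻¹' Nᶜ with hG
  have hGm : MeasurableSet G := (measurableSet_regularSet J).inter (hQm hNm.compl)
  have hRQ : ∀ z ∈ G, R (Q z) = J z := fun z hz => ((H _ hz.2).2.2 _ (hJ z).1 (hJ z).2).symm
  have hJinj : InjOn J G := fun z _ z' hz' e => hinj z' hz'.1 z e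
  have hQinj : InjOn Q G := fun z hz z' hz' e => by
    have : J z = J z' := by rw [← hRQ z hz, ← hRQ z' hz', e]
    exact hinj z' hz'.1 z this
  have hJd : ∀ z ∈ G, HasFDerivAt J (fderiv ℝ J z) z := fun z hz => hz.1.1.hasFDerivAt
  have hQd : ∀ z ∈ G, HasFDerivAt Q (ContinuousLinearMap.id ℝ E - fderiv ℝ J z) z :=
    fun z hz => (hasFDerivAt_id z).sub (hJd z hz)
  have hdet : Measurable fun z => (ContinuousLinearMap.id ℝ E - fderiv ℝ J z).det :=
    ContinuousLinearMap.continuous_det.measurable.comp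
      (measurable_const.sub (measurable_fderiv ℝ J))
  have hgood : ∀ᵐ x ∂μ.restrict S, T x ∈ subdiff S v x ∧ T x ∉ N ∧ x ∈ S ∧
      x ∉ J '' (regularSet J)ᶜ := by
    filter_upwards [h.ae_mem, h.ae_notMem hNm hN0, ae_restrict_mem h.isCompact.measurableSet,
      ae_restrict_of_ae
        (compl_mem_ae_iff.2 (addHaar_image_compl_regularSet (μ := μ) hJ.lipschitz))]
      with x h1 h2 h3 h4 using ⟨h1, h2, h3, h4⟩
  have hpre : ∀ x, T x ∈ subdiff S v x → T x ∉ N → x ∈ S → x ∉ J '' (regularSet J)ᶜ →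
      ∃ z ∈ G, J z = x ∧ T x = Q z := by
    intro x h1 h2 h3 h4
    have h5 := hJ.apply_add h3 h1
    have h6 : T x = Q (x + T x) := by simp only [hQ, h5]; abel
    refine ⟨x + T x, ⟨?_, ?_⟩, h5, h6⟩
    · by_contra hc
      exact h4 ⟨_, hc, h5⟩
    · rw [mem_preimage, ← h6]
      exact h2
  -- By change of variables the two sides are the ω-mass of Q(s) and c times the volume of J(s).
  -- They agree since, for almost every x in S, T x ∈ Q(s) exactly when x ∈ J(s).
  have hint : ∀ s, MeasurableSet s → s ⊆ G →
      ∫⁻ z in s, ENNReal.ofReal |(ContinuousLinearMap.id ℝ E - fderiv ℝ J z).det| * ω (Q z) ∂μ =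
        ∫⁻ z in s, c * ENNReal.ofReal |(fderiv ℝ J z).det| ∂μ := by
    intro s hs hsG
    have hQi : MeasurableSet (Q '' s) := measurable_image_of_fderivWithin hs
      (fun z hz => (hQd z (hsG hz)).hasFDerivWithinAt) (hQinj.mono hsG)
    have hJi : MeasurableSet (J '' s) := measurable_image_of_fderivWithin hs
      (fun z hz => (hJd z (hsG hz)).hasFDerivWithinAt) (hJinj.mono hsG)
    rw [← lintegral_image_eq_lintegral_abs_det_fderiv_mul μ hs
      (fun z hz => (hQd z (hsG hz)).hasFDerivWithinAt) (hQinj.mono hsG),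
      ← MeasureTheory.withDensity_apply _ hQi, h.withDensity_apply hQi,
      lintegral_const_mul _ (measurable_det_fderiv J).abs.ennreal_ofReal,
      lintegral_abs_det_fderiv_eq_addHaar_image μ hs
        (fun z hz => (hJd z (hsG hz)).hasFDerivWithinAt) (hJinj.mono hsG)]
    congr 1
    have hJS : J '' s ⊆ S := image_subset_iff.2 fun z _ => (hJ z).1
    rw [← inter_eq_self_of_subset_left hJS, ← Measure.restrict_apply hJi]
    refine measure_congr (eventuallyEq_set.2 ?_)
    filter_upwards [hgood] with x ⟨h1, h2, h3, h4⟩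
    obtain ⟨z, hz, hzx, hTz⟩ := hpre x h1 h2 h3 h4
    refine ⟨?_, ?_⟩
    · rintro ⟨z', hz', e⟩
      refine ⟨z', hz', ?_⟩
      rw [hQinj (hsG hz') hz (e.trans hTz), hzx]
    · rintro ⟨z', hz', e⟩
      refine ⟨z', hz', ?_⟩
      rw [hTz, hJinj (hsG hz') hz (e.trans hzx.symm)]
  have hae : ∀ᵐ z ∂μ.restrict G,
      ENNReal.ofReal |(ContinuousLinearMap.id ℝ E - fderiv ℝ J z).det| * ω (Q z) =
        c * ENNReal.ofReal |(fderiv ℝ J z).det| := by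
    refine ae_eq_of_forall_setLIntegral_eq_of_sigmaFinite
      (hdet.abs.ennreal_ofReal.mul (h.measurable_density.comp hQm))
      ((measurable_det_fderiv J).abs.ennreal_ofReal.const_mul c) fun s hs _ => ?_
    rw [Measure.restrict_restrict hs]
    exact hint _ (hs.inter hGm) inter_subset_right
  rw [ae_restrict_iff' hGm, ae_iff] at hae
  -- The identity holds for almost every z; J being Lipschitz, the exceptional z cover only a null
  -- set of x.
  have hnull := addHaar_image_eq_zero_of_lipschitz hJ.lipschitz hae
  filter_upwards [hgood, ae_restrict_of_ae
    (compl_mem_ae_iff.2 hnull)] with x ⟨h1, h2, h3, h4⟩ h5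
  obtain ⟨z, hz, hzx, hTz⟩ := hpre x h1 h2 h3 h4
  have hQz : Q z = z - x := by rw [← hzx]
  refine ⟨z, hz.1, hzx, by rw [hTz, hQz], ?_⟩
  by_contra hcon
  refine h5 ⟨z, ?_, hzx⟩
  simp only [mem_ofPred_eq, Classical.not_imp]
  exact ⟨hz, by rwa [hQz]⟩

end IsSubgradientTransport
end MeasureTheoretic

/-! ### Compact subgradient graphs and the pointwise Monge–Ampère equation. -/

/-- Compactness of the graph of a subdifferential with subgradients in a compact set. -/
theorem isCompact_subgradient_graph {X Y : Type*} [TopologicalSpace X] [TopologicalSpace Y]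
    [T2Space X] [T2Space Y] {S : Set X} {K : Set Y} (hS : IsCompact S) (hK : IsCompact K)
    {u : X → ℝ} (hu : ContinuousOn u S) {b : X → X → Y → ℝ}
    (hb : ∀ x', Continuous fun q : X × Y => b q.1 x' q.2) :
    IsCompact {q : X × Y | q ∈ S ×ˢ K ∧ ∀ x' ∈ S, u q.1 + b q.1 x' q.2 ≤ u x'} := by
  have hSK : IsCompact (S ×ˢ K) := hS.prod hK
  have : {q : X × Y | q ∈ S ×ˢ K ∧ ∀ x' ∈ S, u q.1 + b q.1 x' q.2 ≤ u x'} =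
      S ×ˢ K ∩ ⋂ x' ∈ S, S ×ˢ K ∩ (fun q : X × Y => u q.1 + b q.1 x' q.2) ⁻¹' Iic (u x') := by
    ext q
    simp only [mem_ofPred_eq, mem_inter_iff, mem_iInter₂, mem_preimage, mem_Iic]
    exact ⟨fun h => ⟨h.1, fun x' hx' => ⟨h.1, h.2 x' hx'⟩⟩, fun h => ⟨h.1, fun x' hx' => (h.2 x' hx').2⟩⟩
  rw [this]
  refine hSK.inter_right (isClosed_biInter fun x' _ => ?_)
  refine ContinuousOn.preimage_isClosed_of_isClosed ?_ hSK.isClosed isClosed_Iic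
  exact (hu.comp continuousOn_fst fun q hq => hq.1).add (hb x').continuousOn

section

open scoped RealInnerProductSpace

variable {E : Type*} [NormedAddCommGroup E] [InnerProductSpace ℝ E] [FiniteDimensional ℝ E]

theorem det_nonneg_of_isPositive {A : E →ₗ[ℝ] E} (hA : A.IsPositive) : 0 ≤ LinearMap.det A := by
  have b := stdOrthonormalBasis ℝ E
  have := ((LinearMap.posSemidef_toMatrix_iff b).2 hA).det_nonneg
  rwa [LinearMap.det_toMatrix] at this

/-- At a point where the proximal map has an invertible derivative `B`, the Hessian `B⁻¹ - 1` is
symmetric, with determinant `det (1 - B) / det B ≥ 0`. -/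
theorem IsProx.hessian {S : Set E} {v : E → ℝ} {J : E → E} (hJ : IsProx S v J) {B : E ≃L[ℝ] E}
    {z : E} (hB : HasFDerivAt J (B : E →L[ℝ] E) z) :
    LinearMap.IsSymmetric ((B.symm : E →L[ℝ] E) - ContinuousLinearMap.id ℝ E : E →ₗ[ℝ] E) ∧
    |(ContinuousLinearMap.id ℝ E - (B : E →L[ℝ] E)).det| =
      ((B.symm : E →L[ℝ] E) - ContinuousLinearMap.id ℝ E).det * |(B : E →L[ℝ] E).det| := by
  have hsymm : LinearMap.IsSymmetric
      ((B.symm : E →L[ℝ] E) - ContinuousLinearMap.id ℝ E : E →ₗ[ℝ] E) := by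
    intro x y
    have := hJ.deriv_symm hB (B.symm x) (B.symm y)
    simp at this
    simp [inner_sub_left, inner_sub_right, this]
  have hpos : LinearMap.IsPositive
      ((B.symm : E →L[ℝ] E) - ContinuousLinearMap.id ℝ E : E →ₗ[ℝ] E) := by
    refine (LinearMap.isPositive_iff _).2 ⟨hsymm, fun x => ?_⟩
    have := hJ.norm_sq_deriv_le hB (B.symm x)
    simp at this
    simp [inner_sub_left]
    rwa [real_inner_comm] at this
  refine ⟨hsymm, ?_⟩
  have h0 := det_nonneg_of_isPositive hpos
  have h1 : (ContinuousLinearMap.id ℝ E - (B : E →L[ℝ] E) : E →L[ℝ] E) =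
      ((B.symm : E →L[ℝ] E) - ContinuousLinearMap.id ℝ E) * (B : E →L[ℝ] E) := by
    ext x
    simp
  have h2 : (ContinuousLinearMap.id ℝ E - (B : E →L[ℝ] E)).det =
      ((B.symm : E →L[ℝ] E) - ContinuousLinearMap.id ℝ E).det * (B : E →L[ℝ] E).det := by
    rw [h1]
    exact LinearMap.det_comp _ _
  rw [h2, abs_mul]
  congr 1
  exact abs_of_nonneg h0

variable [MeasurableSpace E] [BorelSpace E] {μ : Measure E} [μ.IsAddHaarMeasure]
  {S : Set E} {v : E → ℝ} {ω : E → ℝ≥0∞} {c : ℝ≥0∞} {T : E → E}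

omit [FiniteDimensional ℝ E] in
/-- Interior points have subgradients. -/
theorem IsSubgradientTransport.subdiff_nonempty (h : IsSubgradientTransport μ S v ω c T)
    {K : Set E} (hK : IsCompact K) (hTK : ∀ᵐ x ∂μ.restrict S, T x ∈ K) {x : E}
    (hx : x ∈ interior S) : (subdiff S v x).Nonempty := by
  have hgraph := isCompact_subgradient_graph h.isCompact hK h.continuousOn
    (b := fun x x' p => ⟪x' - x, p⟫) (fun x' => by fun_prop)
  -- D is the set of points with a subgradient in K. It is closed and contains almost all of S, so
  -- the open set `interior S \ D` is null, hence empty.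
  set D := Prod.fst '' {q : E × E | q ∈ S ×ˢ K ∧ ∀ x' ∈ S, v q.1 + ⟪x' - q.1, q.2⟫ ≤ v x'}
  have hD : IsClosed D := (hgraph.image continuous_fst).isClosed
  have h0 : μ (interior S \ D) = 0 := by
    have : ∀ᵐ x ∂μ.restrict S, x ∈ D := by
      filter_upwards [h.ae_mem, hTK, ae_restrict_mem h.isCompact.measurableSet] with x h1 h2 h3
      exact ⟨(x, T x), ⟨⟨h3, h2⟩, h1⟩, rfl⟩
    rw [ae_restrict_iff' h.isCompact.measurableSet, ae_iff] at this
    refine measure_mono_null (fun x hx => ?_) this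
    exact fun hxD => hx.2 (hxD (interior_subset hx.1))
  have h1 : interior S \ D = ∅ :=
    ((isOpen_interior.sdiff hD).measure_eq_zero_iff μ).1 h0
  have hxD : x ∈ D := by
    by_contra hcon
    exact (h1.subset ⟨hx, hcon⟩ : x ∈ (∅ : Set E))
  obtain ⟨q, ⟨-, hq⟩, rfl⟩ := hxD
  exact ⟨q.2, hq⟩

/-- The Monge–Ampère equation holds almost everywhere in the sense of Alexandrov. -/
theorem IsSubgradientTransport.ae_mongeAmpere (h : IsSubgradientTransport μ S v ω c T)
    {K : Set E} (hK : IsCompact K) (hTK : ∀ᵐ x ∂μ.restrict S, T x ∈ K) :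
    ∀ᵐ x ∂μ.restrict S, x ∈ interior S → ∃ A : E →L[ℝ] E, (A : E →ₗ[ℝ] E).IsSymmetric ∧
      ((fun w => v (x + w) - v x - ⟪T x, w⟫ - ⟪A w, w⟫ / 2) =o[𝓝 0] fun w => ‖w‖ ^ 2) ∧
      0 ≤ A.det ∧ ENNReal.ofReal A.det * ω (T x) = c := by
  obtain ⟨J, hJ⟩ := exists_isProx h.isCompact h.nonempty h.convexOn h.continuousOn
  filter_upwards [h.ae_jacobian_eq hJ] with x ⟨z, hz, hzx, hTx, heq⟩ hxS
  subst hzx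
  set B : E ≃L[ℝ] E := (fderiv ℝ J z).toContinuousLinearEquivOfDetNeZero hz.2
  have hBd : (B : E →L[ℝ] E) = fderiv ℝ J z :=
    ContinuousLinearMap.coe_toContinuousLinearEquivOfDetNeZero _ _
  have hB : HasFDerivAt J (B : E →L[ℝ] E) z := by rw [hBd]; exact hz.1.hasFDerivAt
  obtain ⟨hsymm, hdet⟩ := hJ.hessian hB
  have hBpos : 0 < |(B : E →L[ℝ] E).det| := abs_pos.2 (by rw [hBd]; exact hz.2)
  have h0 : 0 ≤ ((B.symm : E →L[ℝ] E) - ContinuousLinearMap.id ℝ E).det :=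
    nonneg_of_mul_nonneg_left (hdet ▸ abs_nonneg _) hBpos
  refine ⟨(B.symm : E →L[ℝ] E) - ContinuousLinearMap.id ℝ E, hsymm, ?_, h0, ?_⟩
  · rw [hTx]
    refine hJ.second_order_expansion hB ?_
    have : Tendsto (fun w => J z + w) (𝓝 0) (𝓝 (J z)) := by
      simpa using (continuous_const_add (J z)).tendsto 0
    filter_upwards [this.eventually (isOpen_interior.mem_nhds hxS)] with w hw
    exact ⟨interior_subset hw, h.subdiff_nonempty hK hTK hw⟩
  · rw [← hBd, hdet, ENNReal.ofReal_mul h0, mul_right_comm] at heq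
    rw [hTx]
    exact (ENNReal.mul_left_inj (by simpa using hBpos.ne') ENNReal.ofReal_ne_top).1 heq

end

/-! ### The dual complex in gradient coordinates. -/

/-- A linear automorphism of `ℝ^m` preserving the lattice `ℤ^m` preserves Lebesgue measure. -/
theorem measurePreserving_of_int_matrix {m : ℕ} (L : (Fin m → ℝ) ≃ₗ[ℝ] (Fin m → ℝ))
    (hL : ∀ i j, ∃ z : ℤ, L (Pi.single j 1) i = z)
    (hL' : ∀ i j, ∃ z : ℤ, L.symm (Pi.single j 1) i = z) :
    MeasurePreserving L (volume : Measure (Fin m → ℝ)) volume := by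
  choose M hM using hL
  choose N hN using hL'
  have key : ∀ (f : (Fin m → ℝ) →ₗ[ℝ] (Fin m → ℝ)) (A : Fin m → Fin m → ℤ),
      (∀ i j, f (Pi.single j 1) i = A i j) → LinearMap.det f = ((Matrix.of A).det : ℝ) := by
    intro f A hA
    have : LinearMap.toMatrix' f = (Matrix.of A).map (Int.cast : ℤ → ℝ) := by
      ext i j
      rw [LinearMap.toMatrix'_apply, Matrix.map_apply, Matrix.of_apply, ← hA]
    rw [← LinearMap.det_toMatrix', this]
    exact ((Int.castRingHom ℝ).map_det _).symm
  have h1 := key (L : (Fin m → ℝ) →ₗ[ℝ] (Fin m → ℝ)) M hM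
  have h2 := key (L.symm : (Fin m → ℝ) →ₗ[ℝ] (Fin m → ℝ)) N hN
  have h3 := LinearEquiv.det_mul_det_symm L
  rw [h1, h2] at h3
  have h4 : (Matrix.of M).det * (Matrix.of N).det = 1 := by exact_mod_cast h3
  -- The determinant is an integer with an integer inverse, hence ±1.
  have h5 : |LinearMap.det (L : (Fin m → ℝ) →ₗ[ℝ] (Fin m → ℝ))| = 1 := by
    rw [h1]
    rcases Int.isUnit_iff.1 (IsUnit.of_mul_eq_one _ h4) with h | h <;> simp [h]
  have h6 : LinearMap.det (L : (Fin m → ℝ) →ₗ[ℝ] (Fin m → ℝ)) ≠ 0 := by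
    intro h
    simp [h] at h5
  refine ⟨L.toContinuousLinearEquiv.continuous.measurable, ?_⟩
  have := Real.map_linearMap_volume_pi_eq_smul_volume_pi h6
  rw [abs_inv, h5, inv_one, ENNReal.ofReal_one, one_smul] at this
  exact this

/-- The gradient coordinates on the cell `p_j = 0`, as a linear automorphism of `ℝ^m`. -/
noncomputable def cellEquiv {m : ℕ} (j : Fin (m + 1)) : (Fin m → ℝ) ≃ₗ[ℝ] (Fin m → ℝ) where
  toFun q := gradCoord (j.insertNth (0 : ℝ) q : Fin (m + 1) → ℝ)
  -- The representative with p_0 = 0 is shifted along (1, …, 1) until its j-th coordinate vanishes.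
  invFun r := fun i => (Fin.cons 0 r : Fin (m + 1) → ℝ) (j.succAbove i) -
    (Fin.cons 0 r : Fin (m + 1) → ℝ) j
  map_add' q q' := by
    have : (j.insertNth (0 : ℝ) (q + q') : Fin (m + 1) → ℝ) =
        j.insertNth (0 : ℝ) q + j.insertNth (0 : ℝ) q' := by
      ext i
      refine Fin.succAboveCases j ?_ (fun i => ?_) i <;> simp
    rw [this]
    ext i
    simp only [gradCoord, Pi.add_apply]
    ring
  map_smul' c q := by
    have : (j.insertNth (0 : ℝ) (c • q) : Fin (m + 1) → ℝ) = c • j.insertNth (0 : ℝ) q := by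
      ext i
      refine Fin.succAboveCases j ?_ (fun i => ?_) i <;> simp
    rw [this]
    ext i
    simp only [gradCoord, Pi.smul_apply, smul_eq_mul, RingHom.id_apply]
    ring
  left_inv q := by
    set p : Fin (m + 1) → ℝ := j.insertNth (0 : ℝ) q with hp
    have h : ∀ i, (Fin.cons 0 (gradCoord p) : Fin (m + 1) → ℝ) i = p i - p 0 := by
      intro i
      refine Fin.cases ?_ (fun i => ?_) i <;> simp [gradCoord]
    ext i
    change (Fin.cons 0 (gradCoord p) : Fin (m + 1) → ℝ) (j.succAbove i) -
      (Fin.cons 0 (gradCoord p) : Fin (m + 1) → ℝ) j = q i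
    rw [h, h]
    simp [hp]
  right_inv r := by
    set s : Fin (m + 1) → ℝ := Fin.cons 0 r with hs
    have h : (j.insertNth (0 : ℝ) (fun i => s (j.succAbove i) - s j) : Fin (m + 1) → ℝ) =
        fun i => s i - s j := by
      ext i
      refine Fin.succAboveCases j ?_ (fun i => ?_) i <;> simp
    change gradCoord (j.insertNth (0 : ℝ) (fun i => s (j.succAbove i) - s j) :
      Fin (m + 1) → ℝ) = r
    rw [h]
    ext i
    simp [gradCoord, hs]

theorem measurePreserving_cellEquiv {m : ℕ} (j : Fin (m + 1)) :
    MeasurePreserving (cellEquiv j) (volume : Measure (Fin m → ℝ)) volume := by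
  have hsub : ∀ x y : ℝ, (∃ z : ℤ, x = z) → (∃ z : ℤ, y = z) → ∃ z : ℤ, x - y = z := by
    rintro _ _ ⟨a, rfl⟩ ⟨b, rfl⟩
    exact ⟨a - b, by push_cast; rfl⟩
  have hs : ∀ a b : Fin m, ∃ z : ℤ, (Pi.single a (1 : ℝ) : Fin m → ℝ) b = z := by
    intro a b
    by_cases h : b = a
    · exact ⟨1, by simp [h]⟩
    · exact ⟨0, by simp [h]⟩
  refine measurePreserving_of_int_matrix _ (fun i k => hsub _ _ ?_ ?_) (fun i k => hsub _ _ ?_ ?_)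
  · refine Fin.succAboveCases j ⟨0, by simp⟩ (fun i => ?_) i.succ
    simpa using hs k i
  · refine Fin.succAboveCases j ⟨0, by simp⟩ (fun i => ?_) (0 : Fin (m + 1))
    simpa using hs k i
  · refine Fin.cases ⟨0, by simp⟩ (fun i => ?_) (j.succAbove i)
    simpa using hs k i
  · refine Fin.cases ⟨0, by simp⟩ (fun i => ?_) j
    simpa using hs k i

section Euclidean

variable {m : ℕ} {d : Fin (m + 1) → ℕ}

/-- The gradient coordinates, in Euclidean space. -/
noncomputable def gradE (p : Fin (m + 1) → ℝ) : EuclideanSpace ℝ (Fin m) :=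
  WithLp.toLp 2 (gradCoord p)

@[fun_prop]
theorem continuous_gradCoord : Continuous (gradCoord : (Fin (m + 1) → ℝ) → Fin m → ℝ) := by
  unfold gradCoord
  fun_prop

@[fun_prop]
theorem continuous_gradE : Continuous (gradE : (Fin (m + 1) → ℝ) → EuclideanSpace ℝ (Fin m)) := by
  unfold gradE
  fun_prop

theorem measurable_gradE :
    Measurable (gradE : (Fin (m + 1) → ℝ) → EuclideanSpace ℝ (Fin m)) :=
  continuous_gradE.measurable

theorem gradE_eq_iff {p p' : Fin (m + 1) → ℝ} : gradE p = gradE p' ↔ ∀ i, p i - p 0 = p' i - p' 0 := by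
  rw [gradE, gradE, (WithLp.toLp_injective 2).eq_iff, funext_iff]
  refine ⟨fun h i => ?_, fun h i => h i.succ⟩
  refine Fin.cases (by simp) (fun i => h i) i

/-- Each class of `ℝ^{m+1} / ℝ(1, …, 1)` meets the complex at most once. -/
theorem eq_of_gradE_eq {p p' : Fin (m + 1) → ℝ} (hp : p ∈ dualComplex d) (hp' : p' ∈ dualComplex d)
    (h : gradE p = gradE p') : p = p' := by
  rw [gradE_eq_iff] at h
  obtain ⟨k, h1, -, h2⟩ := mem_iUnion.1 hp
  obtain ⟨k', h1', -, h2'⟩ := mem_iUnion.1 hp'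
  -- p - p' is a constant vector; it is nonnegative at k, where p vanishes, and nonpositive at k',
  -- where p' vanishes.
  have a := h k
  have b := h k'
  have c := h1 k'
  have e := h1' k
  ext i
  have := h i
  linarith

/-- The point of `ℝ^{m+1}` with maximal coordinate `0` and given gradient coordinates. -/
noncomputable def section₀ (q : EuclideanSpace ℝ (Fin m)) : Fin (m + 1) → ℝ := fun i =>
  (Fin.cons 0 (WithLp.ofLp q) : Fin (m + 1) → ℝ) i -
    Finset.univ.sup' Finset.univ_nonempty (Fin.cons 0 (WithLp.ofLp q) : Fin (m + 1) → ℝ)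

theorem continuous_section₀ :
    Continuous (section₀ : EuclideanSpace ℝ (Fin m) → Fin (m + 1) → ℝ) := by
  have h : ∀ i, Continuous fun q : EuclideanSpace ℝ (Fin m) =>
      (Fin.cons 0 (WithLp.ofLp q) : Fin (m + 1) → ℝ) i := by
    intro i
    refine Fin.cases ?_ (fun i => ?_) i
    · simpa using continuous_const
    · simp only [Fin.cons_succ]
      fun_prop
  exact continuous_pi fun i => (h i).sub
    (Continuous.finset_sup'_apply Finset.univ_nonempty fun i _ => h i)

theorem section₀_gradE {p : Fin (m + 1) → ℝ} (hp : p ∈ dualComplex d) : section₀ (gradE p) = p := by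
  obtain ⟨k, h1, -, h2⟩ := mem_iUnion.1 hp
  have h : (Fin.cons 0 (WithLp.ofLp (gradE p)) : Fin (m + 1) → ℝ) = fun i => p i - p 0 := by
    ext i
    refine Fin.cases ?_ (fun i => ?_) i <;> simp [gradE, gradCoord]
  have hs : Finset.univ.sup' Finset.univ_nonempty (fun i => p i - p 0) = - p 0 := by
    refine le_antisymm (Finset.sup'_le _ _ fun i _ => by linarith [h1 i]) ?_
    have := Finset.le_sup' (fun i => p i - p 0) (Finset.mem_univ k)
    simp only [h2, zero_sub] at this
    exact this
  ext i
  rw [section₀, h, hs]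
  ring

theorem convex_dualCell (k : Fin (m + 1)) : Convex ℝ (dualCell d k) := by
  have h1 : Convex ℝ {p : Fin (m + 1) → ℝ | ∀ i, p i ≤ 0} := convex_Iic 0
  have h2 : Convex ℝ {p : Fin (m + 1) → ℝ | -1 ≤ ∑ i, (d i : ℝ) * p i} :=
    convex_halfSpace_ge ⟨fun x y => by simp [mul_add, Finset.sum_add_distrib],
      fun c x => by simp [Finset.mul_sum]; congr; ext; ring⟩ _
  have h3 : Convex ℝ {p : Fin (m + 1) → ℝ | p k = 0} :=
    convex_hyperplane ⟨fun x y => by simp, fun c x => by simp⟩ _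
  exact h1.inter (h2.inter h3)

theorem isCompact_dualCell (hd : ∀ i, 0 < d i) (k : Fin (m + 1)) : IsCompact (dualCell d k) := by
  refine Metric.isCompact_of_isClosed_isBounded ?_ ?_
  · refine IsClosed.inter ?_ (IsClosed.inter ?_ ?_)
    · exact isClosed_Iic (a := (0 : Fin (m + 1) → ℝ))
    · exact isClosed_le continuous_const
        (continuous_finsetSum _ fun i _ => continuous_const.mul (continuous_apply i))
    · exact isClosed_eq (continuous_apply k) continuous_const
  -- All terms are nonpositive and d_i ≥ 1, so -1 ≤ ∑ d_j p_j ≤ d_i p_i ≤ p_i.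
  · refine (Metric.isBounded_Icc (fun _ : Fin (m + 1) => (-1 : ℝ)) 0).subset fun p hp => ⟨fun i => ?_, hp.1⟩
    have h1 : ∑ j, (d j : ℝ) * p j ≤ (d i : ℝ) * p i := by
      rw [← Finset.add_sum_erase _ _ (Finset.mem_univ i)]
      have : ∑ j ∈ Finset.univ.erase i, (d j : ℝ) * p j ≤ 0 :=
        Finset.sum_nonpos fun j _ => mul_nonpos_of_nonneg_of_nonpos (by positivity) (hp.1 j)
      linarith
    have h2 : (1 : ℝ) ≤ d i := by exact_mod_cast hd i
    have h3 := hp.2.1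
    have h4 := hp.1 i
    simp only
    nlinarith

theorem isCompact_dualComplex (hd : ∀ i, 0 < d i) : IsCompact (dualComplex d) :=
  isCompact_iUnion fun k => isCompact_dualCell hd k

theorem measurePreserving_gradE_insertNth (j : Fin (m + 1)) :
    MeasurePreserving (fun q : Fin m → ℝ => gradE (j.insertNth (0 : ℝ) q : Fin (m + 1) → ℝ)) :=
  (PiLp.volume_preserving_toLp (Fin m)).comp (measurePreserving_cellEquiv j)

theorem measurable_insertNth (j : Fin (m + 1)) :
    Measurable fun q : Fin m → ℝ => (j.insertNth (0 : ℝ) q : Fin (m + 1) → ℝ) := by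
  refine measurable_pi_lambda _ fun i => ?_
  refine Fin.succAboveCases j ?_ (fun i => ?_) i
  · simp
  · simpa using measurable_pi_apply i

theorem preimage_gradE_image_dualCell (j : Fin (m + 1)) :
    (fun q : Fin m → ℝ => gradE (j.insertNth (0 : ℝ) q : Fin (m + 1) → ℝ)) ⁻¹'
      (gradE '' dualCell d j) =
    (fun q : Fin m → ℝ => (j.insertNth (0 : ℝ) q : Fin (m + 1) → ℝ)) ⁻¹' dualCell d j := by
  ext q
  refine ⟨?_, fun h => ⟨_, h, rfl⟩⟩
  rintro ⟨p, hp, h⟩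
  rw [gradE_eq_iff] at h
  have h1 := h j
  rw [hp.2.2, Fin.insertNth_apply_same] at h1
  have : (j.insertNth (0 : ℝ) q : Fin (m + 1) → ℝ) = p := by
    ext i
    linarith [h i]
  rw [mem_preimage, this]
  exact hp

/-- In gradient coordinates, `dp` is Lebesgue measure. -/
theorem map_gradE_dualVol (hd : ∀ i, 0 < d i) :
    (dualVol d).map gradE = volume.restrict (gradE '' dualComplex d) := by
  have hK : ∀ j, MeasurableSet (gradE '' dualCell d j) := fun j =>
    ((isCompact_dualCell hd j).image continuous_gradE).measurableSet
  -- Two distinct cells meet inside a coordinate hyperplane, so the sum over cells becomes a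
  -- restriction to their union.
  have hdisj : Pairwise (fun j k =>
      AEDisjoint (volume : Measure (EuclideanSpace ℝ (Fin m)))
        (gradE '' dualCell d j) (gradE '' dualCell d k)) := by
    intro j k hjk
    obtain ⟨i, rfl⟩ := Fin.exists_succAbove_eq hjk.symm
    have h0 : volume {q : Fin m → ℝ | q i = 0} = 0 :=
      Measure.pi_hyperplane (fun _ => (volume : Measure ℝ)) i 0
    unfold AEDisjoint
    rw [← (measurePreserving_gradE_insertNth j).measure_preimage
      ((hK j).inter (hK _)).nullMeasurableSet]
    refine measure_mono_null (fun q hq => ?_) h0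
    obtain ⟨⟨p, hp, e⟩, ⟨p', hp', e'⟩⟩ := hq
    have hpp : p = p' := eq_of_gradE_eq (mem_iUnion.2 ⟨_, hp⟩) (mem_iUnion.2 ⟨_, hp'⟩)
      (e.trans e'.symm)
    subst hpp
    rw [gradE_eq_iff] at e
    have h1 := e j
    have h2 := e (j.succAbove i)
    rw [hp.2.2, Fin.insertNth_apply_same] at h1
    rw [hp'.2.2, Fin.insertNth_apply_succAbove] at h2
    change q i = 0
    linarith
  have hunion : gradE '' dualComplex d = ⋃ j, gradE '' dualCell d j := image_iUnion
  rw [hunion, Measure.restrict_iUnion_ae hdisj fun j => (hK j).nullMeasurableSet,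
    Measure.sum_fintype, dualVol, Measure.map_finset_sum' measurable_gradE.aemeasurable]
  refine Finset.sum_congr rfl fun j _ => ?_
  have hpre := preimage_gradE_image_dualCell (d := d) j
  rw [Measure.restrict_map (measurable_insertNth j) (isCompact_dualCell hd j).measurableSet,
    Measure.map_map measurable_gradE (measurable_insertNth j), ← hpre]
  exact ((measurePreserving_gradE_insertNth j).restrict_preimage (hK j)).map_eq

/-- The density of the target measure in gradient coordinates. -/
noncomputable def densityE (d : Fin (m + 1) → ℕ) (n : ℕ) : EuclideanSpace ℝ (Fin m) → ℝ≥0∞ :=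
  (gradE '' dualComplex d).indicator fun q => ENNReal.ofReal (weight d n (section₀ q))

theorem continuous_weight (n : ℕ) : Continuous (weight d n) := by
  unfold weight
  fun_prop

theorem measurable_densityE (hd : ∀ i, 0 < d i) (n : ℕ) : Measurable (densityE d n) :=
  (((continuous_weight n).comp continuous_section₀).measurable.ennreal_ofReal).indicator
    ((isCompact_dualComplex hd).image continuous_gradE).measurableSet

theorem densityE_gradE (n : ℕ) {p : Fin (m + 1) → ℝ} (hp : p ∈ dualComplex d) :
    densityE d n (gradE p) = ENNReal.ofReal (weight d n p) := by
  rw [densityE, indicator_of_mem (mem_image_of_mem _ hp), section₀_gradE hp]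

theorem ae_mem_dualComplex (hd : ∀ i, 0 < d i) : ∀ᵐ p ∂(dualVol d), p ∈ dualComplex d := by
  rw [dualVol, ← Measure.sum_fintype, Measure.ae_sum_iff]
  intro j
  filter_upwards [ae_restrict_mem (isCompact_dualCell hd j).measurableSet] with p hp
  exact mem_iUnion.2 ⟨j, hp⟩

theorem map_gradE_weightedDualVol (hd : ∀ i, 0 < d i) (n : ℕ) :
    (weightedDualVol d n).map gradE = volume.withDensity (densityE d n) := by
  have hKm := ((isCompact_dualComplex hd).image continuous_gradE).measurableSet
  ext A hA
  rw [Measure.map_apply measurable_gradE hA, weightedDualVol,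
    withDensity_apply _ (measurable_gradE hA), withDensity_apply _ hA]
  have h1 : ∫⁻ q in A, densityE d n q = ∫⁻ q in A, densityE d n q ∂((dualVol d).map gradE) := by
    rw [map_gradE_dualVol hd, Measure.restrict_restrict hA, densityE,
      setLIntegral_indicator hKm, setLIntegral_indicator hKm, inter_comm A, ← inter_assoc,
      inter_self]
  rw [h1, setLIntegral_map hA (measurable_densityE hd n) measurable_gradE]
  refine lintegral_congr_ae (ae_restrict_of_ae ?_)
  filter_upwards [ae_mem_dualComplex hd] with p hp
  rw [densityE_gradE n hp]

end Euclidean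

/-! ### Dirichlet integrals and the value of the constant. -/

theorem lintegral_Icc_pow_sub {a C r : ℝ} (ha : 0 < a) (hC : 0 ≤ C) (hr : 0 ≤ r) (N : ℕ) :
    ∫⁻ t in Icc 0 (r / a), ENNReal.ofReal ((r - a * t) ^ N * C) =
      ENNReal.ofReal (r ^ (N + 1) * (C / ((N + 1) * a))) := by
  have hcont : Continuous fun t : ℝ => (r - a * t) ^ N * C := by fun_prop
  rw [← ofReal_integral_eq_lintegral_ofReal]
  · congr 1
    rw [integral_Icc_eq_integral_Ioc,
      ← intervalIntegral.integral_of_le (div_nonneg hr ha.le), intervalIntegral.integral_mul_const,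
      intervalIntegral.integral_comp_sub_mul (fun x : ℝ => x ^ N) ha.ne', mul_div_cancel₀ _ ha.ne',
      integral_pow]
    simp
    field_simp
  · exact hcont.continuousOn.integrableOn_Icc
  · filter_upwards [ae_restrict_mem measurableSet_Icc] with t ht
    have h1 : a * t ≤ r := by
      have := (le_div_iff₀ ha).1 ht.2
      linarith
    have : 0 ≤ r - a * t := by linarith
    positivity

/-- The solid simplex `q ≥ 0`, `∑ a_i q_i ≤ r`. -/
def scaledSimplex {m : ℕ} (a : Fin m → ℝ) (r : ℝ) : Set (Fin m → ℝ) :=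
  {q | (∀ i, 0 ≤ q i) ∧ ∑ i, a i * q i ≤ r}

theorem measurableSet_scaledSimplex {m : ℕ} (a : Fin m → ℝ) (r : ℝ) :
    MeasurableSet (scaledSimplex a r) := by
  have h : Measurable fun q : Fin m → ℝ => ∑ i, a i * q i := by fun_prop
  exact (measurableSet_Ici (a := (0 : Fin m → ℝ))).inter (measurableSet_le h measurable_const)

/-- Dirichlet's integral. -/
theorem lintegral_scaledSimplex (k : ℕ) : ∀ {m : ℕ} (a : Fin m → ℝ), (∀ i, 0 < a i) → ∀ r, 0 ≤ r →
    ∫⁻ q in scaledSimplex a r, ENNReal.ofReal ((r - ∑ i, a i * q i) ^ k) =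
      ENNReal.ofReal (r ^ (m + k) * ((k.factorial : ℝ) / ((m + k).factorial * ∏ i, a i))) := by
  intro m
  induction m with
  | zero =>
    intro a ha r hr
    have : scaledSimplex a r = univ := by
      ext q
      simp [scaledSimplex, hr]
    rw [this, Measure.restrict_univ, Measure.volume_pi_eq_dirac 0, lintegral_dirac]
    simp [Nat.factorial_ne_zero]
  | succ m ih =>
    intro a ha r hr
    have hmp := (volume_preserving_piFinSuccAbove (fun _ : Fin (m + 1) => ℝ) 0).symm
    set F : (Fin (m + 1) → ℝ) → ℝ≥0∞ :=
      (scaledSimplex a r).indicator fun q => ENNReal.ofReal ((r - ∑ i, a i * q i) ^ k) with hF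
    have hFm : Measurable F :=
      Measurable.indicator (by fun_prop) (measurableSet_scaledSimplex a r)
    set C : ℝ := (k.factorial : ℝ) / ((m + k).factorial * ∏ i : Fin m, a i.succ) with hC
    have hP : 0 < ∏ i : Fin m, a i.succ := Finset.prod_pos fun i _ => ha _
    -- The slice q_0 = t is a simplex of the same kind with r replaced by r - a_0 t, which is why
    -- the induction keeps r general.
    have hinner : ∀ t : ℝ, ∫⁻ q, F (Fin.cons t q) =
        (Icc 0 (r / a 0)).indicator
          (fun t => ENNReal.ofReal ((r - a 0 * t) ^ (m + k) * C)) t := by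
      intro t
      by_cases ht : t ∈ Icc 0 (r / a 0)
      · have h1 : a 0 * t ≤ r := by
          have := (le_div_iff₀ (ha 0)).1 ht.2
          linarith
        rw [indicator_of_mem ht, ← ih (fun i => a i.succ) (fun i => ha _) _ (sub_nonneg.2 h1),
          ← lintegral_indicator (measurableSet_scaledSimplex _ _)]
        refine lintegral_congr fun q => ?_
        have hiff : (Fin.cons t q : Fin (m + 1) → ℝ) ∈ scaledSimplex a r ↔
            q ∈ scaledSimplex (fun i => a i.succ) (r - a 0 * t) := by
          simp only [scaledSimplex, mem_ofPred_eq, Fin.forall_fin_succ, Fin.sum_univ_succ,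
            Fin.cons_zero, Fin.cons_succ, ht.1, true_and, le_sub_iff_add_le']
        rw [hF]
        by_cases hq : q ∈ scaledSimplex (fun i => a i.succ) (r - a 0 * t)
        · rw [indicator_of_mem hq, indicator_of_mem (hiff.2 hq), Fin.sum_univ_succ]
          simp only [Fin.cons_zero, Fin.cons_succ, sub_sub]
        · rw [indicator_of_notMem hq, indicator_of_notMem (fun h => hq (hiff.1 h))]
      · rw [indicator_of_notMem ht]
        refine (lintegral_congr fun q => ?_).trans lintegral_zero
        refine indicator_of_notMem (fun h => ht ?_) _
        have h0 : 0 ≤ t := h.1 0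
        have h2 := h.2
        rw [Fin.sum_univ_succ] at h2
        have h3 : 0 ≤ ∑ i : Fin m, a i.succ * (Fin.cons t q : Fin (m + 1) → ℝ) i.succ :=
          Finset.sum_nonneg fun i _ => mul_nonneg (ha _).le (h.1 _)
        rw [Fin.cons_zero] at h2
        exact ⟨h0, (le_div_iff₀ (ha 0)).2 (by linarith)⟩
    rw [← lintegral_indicator (measurableSet_scaledSimplex a r),
      ← hmp.lintegral_comp_emb (MeasurableEquiv.measurableEmbedding _), Measure.volume_eq_prod]
    change lintegral (volume.prod volume)
      (F ∘ (MeasurableEquiv.piFinSuccAbove (fun _ : Fin (m + 1) => ℝ) 0).symm) = _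
    rw [lintegral_prod _ (hFm.comp (MeasurableEquiv.measurable _)).aemeasurable]
    have hcons : ∀ (t : ℝ) (q : Fin m → ℝ),
        (MeasurableEquiv.piFinSuccAbove (fun _ : Fin (m + 1) => ℝ) 0).symm (t, q) =
          (Fin.cons t q : Fin (m + 1) → ℝ) := fun t q => Fin.insertNth_zero' t q
    simp only [Function.comp_apply, hcons, hinner]
    rw [lintegral_indicator measurableSet_Icc, lintegral_Icc_pow_sub (ha 0) (by positivity) hr]
    congr 1
    rw [hC, Fin.prod_univ_succ, show m + 1 + k = m + k + 1 by ring, Nat.factorial_succ]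
    push_cast
    have := (ha 0).ne'
    field_simp

section

variable {m : ℕ} {d : Fin (m + 1) → ℕ}

theorem continuous_param : Continuous (param : (Fin m → ℝ) → Fin (m + 1) → ℝ) := by
  refine continuous_pi fun i => ?_
  refine Fin.cases ?_ (fun i => ?_) i
  · simp only [param, Fin.cons_zero]
    fun_prop
  · simp only [param, Fin.cons_succ]
    fun_prop

theorem sum_param (y : Fin m → ℝ) : ∑ i, param y i = 1 := by
  simp [param, Fin.sum_univ_succ]

theorem measurableSet_simplex : MeasurableSet (simplex m) :=
  (isCompact_stdSimplex ℝ (Fin (m + 1))).measurableSet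

theorem simplexVol_univ : simplexVol m univ = ENNReal.ofReal (1 / m.factorial) := by
  have h := lintegral_scaledSimplex 0 (fun _ : Fin m => (1 : ℝ)) (fun _ => one_pos) 1 zero_le_one
  simp only [pow_zero, ENNReal.ofReal_one, setLIntegral_one] at h
  rw [simplexVol, Measure.restrict_apply_univ, Measure.map_apply continuous_param.measurable
    measurableSet_simplex]
  have : param ⁻¹' simplex m = scaledSimplex (fun _ : Fin m => (1 : ℝ)) 1 := by
    ext y
    simp only [mem_preimage, simplex, stdSimplex, mem_ofPred_eq, sum_param, and_true]
    simp only [scaledSimplex, mem_ofPred_eq, Fin.forall_fin_succ, param, Fin.cons_zero,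
      Fin.cons_succ, one_mul, sub_nonneg]
    exact and_comm
  rw [this, h]
  simp

/-- The substitution q ↦ -q turns the cell into a solid simplex with r = 1 and W into the Dirichlet
integrand of exponent n - m. -/
theorem lintegral_weight_dualCell (hd : ∀ i, 0 < d i) (n : ℕ) (j : Fin (m + 1)) :
    ∫⁻ p in dualCell d j, ENNReal.ofReal (weight d n p) ∂((volume : Measure (Fin m → ℝ)).map
      (fun q => (j.insertNth (0 : ℝ) q : Fin (m + 1) → ℝ))) =
    ENNReal.ofReal (((n - m).factorial : ℝ) /
      ((m + (n - m)).factorial * ∏ i, (d (j.succAbove i) : ℝ))) := by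
  have h := lintegral_scaledSimplex (n - m) (fun i : Fin m => (d (j.succAbove i) : ℝ))
    (fun i => by exact_mod_cast hd _) 1 zero_le_one
  rw [one_pow, one_mul] at h
  rw [← h, setLIntegral_map (isCompact_dualCell hd j).measurableSet
    (continuous_weight n).measurable.ennreal_ofReal (measurable_insertNth j),
    ← (Measure.measurePreserving_neg (volume : Measure (Fin m → ℝ))).setLIntegral_comp_preimage_emb
      (MeasurableEquiv.neg _).measurableEmbedding]
  have hsum : ∀ q : Fin m → ℝ, ∑ i, (d i : ℝ) * (j.insertNth (0 : ℝ) q : Fin (m + 1) → ℝ) i =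
      ∑ i, (d (j.succAbove i) : ℝ) * q i := by
    intro q
    simp [Fin.sum_univ_succAbove _ j]
  have hset : Neg.neg ⁻¹' ((fun q : Fin m → ℝ =>
      (j.insertNth (0 : ℝ) q : Fin (m + 1) → ℝ)) ⁻¹' dualCell d j) =
      scaledSimplex (fun i : Fin m => (d (j.succAbove i) : ℝ)) 1 := by
    ext q
    simp only [mem_preimage, scaledSimplex, dualCell, mem_ofPred_eq, hsum,
      Fin.forall_iff_succAbove j, Fin.insertNth_apply_same, Fin.insertNth_apply_succAbove,
      le_refl, true_and, and_true, Pi.neg_apply, mul_neg, Finset.sum_neg_distrib, neg_nonpos,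
      neg_le_neg_iff]
  rw [hset]
  simp only [weight, hsum, Pi.neg_apply, mul_neg, Finset.sum_neg_distrib, sub_eq_add_neg]

theorem weight_nonneg (n : ℕ) {p : Fin (m + 1) → ℝ} (hp : p ∈ dualComplex d) :
    0 ≤ weight d n p := by
  obtain ⟨k, -, h, -⟩ := mem_iUnion.1 hp
  exact pow_nonneg (by linarith) _

theorem constC1_eq (hd : ∀ i, 0 < d i) {n : ℕ} (hmn : m ≤ n) :
    constC1 d n = (∑ i, (d i : ℝ)) / (∏ i, (d i : ℝ)) *
      (((n - m).factorial : ℝ) / (n.factorial : ℝ)) := by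
  rw [constC1, integral_eq_lintegral_of_nonneg_ae
    ((ae_mem_dualComplex hd).mono fun p hp => weight_nonneg n hp)
    (continuous_weight n).measurable.aestronglyMeasurable, dualVol,
    lintegral_finsetSum_measure]
  simp only [lintegral_weight_dualCell hd]
  rw [← ENNReal.ofReal_sum_of_nonneg fun j _ => by positivity, ENNReal.toReal_ofReal
    (Finset.sum_nonneg fun j _ => by positivity), Nat.add_sub_cancel' hmn, Finset.sum_div,
    Finset.sum_mul]
  refine Finset.sum_congr rfl fun j _ => ?_
  have hpos : ∀ i, (0 : ℝ) < d i := fun i => by exact_mod_cast hd i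
  have := hpos j
  have h2 : 0 < ∏ i, (d (j.succAbove i) : ℝ) := Finset.prod_pos fun i _ => hpos _
  rw [Fin.prod_univ_succAbove _ j]
  field_simp

theorem constC1_pos (hd : ∀ i, 0 < d i) {n : ℕ} (hmn : m ≤ n) : 0 < constC1 d n := by
  have hpos : ∀ i, (0 : ℝ) < d i := fun i => by exact_mod_cast hd i
  rw [constC1_eq hd hmn]
  have h1 : 0 < ∑ i, (d i : ℝ) := Finset.sum_pos (fun i _ => hpos i) Finset.univ_nonempty
  have h2 : 0 < ∏ i, (d i : ℝ) := Finset.prod_pos fun i _ => hpos i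
  positivity

theorem constC1_div_simplexVol (hd : ∀ i, 0 < d i) {n : ℕ} (hmn : m ≤ n) :
    constC1 d n / (simplexVol m univ).toReal =
      (∑ i, (d i : ℝ)) / (∏ i, (d i : ℝ)) *
        (((n - m).factorial : ℝ) * (m.factorial : ℝ) / (n.factorial : ℝ)) := by
  rw [constC1_eq hd hmn, simplexVol_univ, ENNReal.toReal_ofReal (by positivity)]
  field_simp

end

/-! ### The simplex and the quotient in Euclidean coordinates; closedness and null walls. -/

section

open scoped RealInnerProductSpace

variable {m : ℕ} {d : Fin (m + 1) → ℕ} {n : ℕ} {u : (Fin (m + 1) → ℝ) → ℝ}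

/-- The parametrisation of the hyperplane `∑ x_i = 1` by Euclidean space. -/
noncomputable def paramE (y : EuclideanSpace ℝ (Fin m)) : Fin (m + 1) → ℝ := param (WithLp.ofLp y)

/-- The simplex in the coordinates `(x_1, …, x_m)`. -/
def simplexE (m : ℕ) : Set (EuclideanSpace ℝ (Fin m)) := paramE ⁻¹' simplex m

theorem continuous_paramE : Continuous (paramE (m := m)) :=
  continuous_param.comp (PiLp.continuous_ofLp 2 _)

theorem sum_paramE (y : EuclideanSpace ℝ (Fin m)) : ∑ i, paramE y i = 1 := sum_param _

theorem tail_paramE (y : EuclideanSpace ℝ (Fin m)) : Fin.tail (paramE y) = WithLp.ofLp y :=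
  Fin.tail_cons _ _

theorem paramE_tail {x : Fin (m + 1) → ℝ} (hx : ∑ i, x i = 1) :
    paramE (WithLp.toLp 2 (Fin.tail x)) = x := by
  ext i
  refine Fin.cases ?_ (fun i => ?_) i
  · rw [Fin.sum_univ_succ] at hx
    simp only [paramE, param, Fin.cons_zero, Fin.tail]
    linarith
  · simp [paramE, param, Fin.tail]

theorem exists_paramE_of_mem_simplex {x : Fin (m + 1) → ℝ} (hx : x ∈ simplex m) :
    ∃ y ∈ simplexE m, paramE y = x :=
  ⟨_, by rw [simplexE, mem_preimage, paramE_tail hx.2]; exact hx, paramE_tail hx.2⟩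

theorem isClosedEmbedding_paramE : IsClosedEmbedding (paramE (m := m)) :=
  Function.LeftInverse.isClosedEmbedding
    (f := fun x : Fin (m + 1) → ℝ => WithLp.toLp 2 fun i : Fin m => x i.succ)
    (fun y => congrArg (WithLp.toLp 2) (tail_paramE y)) (by fun_prop) continuous_paramE

theorem paramE_add_smul {a b : ℝ} (hab : a + b = 1) (y y' : EuclideanSpace ℝ (Fin m)) :
    paramE (a • y + b • y') = a • paramE y + b • paramE y' := by
  have h0 : ∀ i : Fin m, paramE (a • y + b • y') i.succ =
      (a • paramE y + b • paramE y') i.succ := fun i => by simp [paramE, param]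
  ext i
  refine Fin.cases ?_ h0 i
  simp only [paramE, param, Fin.cons_zero, Pi.add_apply, Pi.smul_apply, smul_eq_mul,
    PiLp.add_apply, PiLp.smul_apply, Finset.sum_add_distrib, ← Finset.mul_sum]
  linear_combination -hab

/-- Differences of points of the hyperplane have coordinate sum 0, so the pairing sees only the p_i
- p_0. -/
theorem dotProduct_paramE_sub (y y' : EuclideanSpace ℝ (Fin m)) (p : Fin (m + 1) → ℝ) :
    (paramE y' - paramE y) ⬝ᵥ p = ⟪y' - y, gradE p⟫ := by
  simp only [dotProduct, Fin.sum_univ_succ, paramE, param, Pi.sub_apply, Fin.cons_zero,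
    Fin.cons_succ, EuclideanSpace.inner_eq_star_dotProduct, gradE, gradCoord, star_trivial,
    PiLp.sub_apply]
  have : ∀ i : Fin m, (p i.succ - p 0) * (y' i - y i) =
      (y' i - y i) * p i.succ - (y' i * p 0 - y i * p 0) := fun i => by ring
  simp only [this, Finset.sum_sub_distrib, ← Finset.sum_mul]
  ring

theorem isCompact_simplexE : IsCompact (simplexE m) :=
  isClosedEmbedding_paramE.isCompact_preimage (isCompact_stdSimplex ℝ _)

theorem convex_simplexE : Convex ℝ (simplexE m) := fun y hy y' hy' a b ha hb hab => by
  rw [simplexE, mem_preimage, paramE_add_smul hab]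
  exact convex_stdSimplex ℝ _ hy hy' ha hb hab

theorem simplexE_nonempty : (simplexE m).Nonempty := by
  obtain ⟨y, hy, -⟩ := exists_paramE_of_mem_simplex (single_mem_stdSimplex ℝ (0 : Fin (m + 1)))
  exact ⟨y, hy⟩

theorem convexOn_comp_paramE (hu : ConvexOn ℝ (simplex m) u) :
    ConvexOn ℝ (simplexE m) (u ∘ paramE) := by
  refine ⟨convex_simplexE, fun y hy y' hy' a b ha hb hab => ?_⟩
  rw [Function.comp_apply, paramE_add_smul hab]
  exact hu.2 hy hy' ha hb hab

theorem mem_subgrad_paramE {y : EuclideanSpace ℝ (Fin m)} {p : Fin (m + 1) → ℝ} :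
    p ∈ subgrad d u (paramE y) ↔ p ∈ dualComplex d ∧ gradE p ∈ subdiff (simplexE m) (u ∘ paramE) y := by
  refine and_congr_right fun _ => ⟨fun h y' hy' => ?_, fun h x' hx' => ?_⟩
  · rw [← dotProduct_paramE_sub]
    exact h _ hy'
  · obtain ⟨y', hy', rfl⟩ := exists_paramE_of_mem_simplex hx'
    rw [dotProduct_paramE_sub]
    exact h y' hy'

theorem simplexVol_eq_map :
    simplexVol m = (volume.restrict (simplexE m)).map paramE := by
  have : (volume : Measure (EuclideanSpace ℝ (Fin m))).map paramE =
      (volume : Measure (Fin m → ℝ)).map param := by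
    rw [← (PiLp.volume_preserving_ofLp (Fin m)).map_eq,
      Measure.map_map continuous_param.measurable (PiLp.continuous_ofLp 2 _).measurable]
    rfl
  rw [simplexVol, ← this, Measure.restrict_map continuous_paramE.measurable measurableSet_simplex]
  rfl

theorem ae_simplexVol_iff {P : (Fin (m + 1) → ℝ) → Prop} :
    (∀ᵐ x ∂(simplexVol m), P x) ↔
      ∀ᵐ y ∂(volume.restrict (simplexE m)), P (paramE y) := by
  rw [simplexVol_eq_map]
  exact isClosedEmbedding_paramE.measurableEmbedding.ae_map_iff

theorem ae_normalizedVol_iff {P : (Fin (m + 1) → ℝ) → Prop} :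
    (∀ᵐ x ∂(normalizedVol m), P x) ↔ ∀ᵐ x ∂(simplexVol m), P x :=
  Measure.ae_ennreal_smul_measure_iff (by rw [simplexVol_univ]; simp)

theorem mem_openSimplex_of_mem_interior {y : EuclideanSpace ℝ (Fin m)}
    (hy : y ∈ interior (simplexE m)) : paramE y ∈ openSimplex m := by
  refine ⟨fun i => ?_, sum_paramE y⟩
  obtain ⟨b, -, hb⟩ := exists_paramE_of_mem_simplex (m := m)
    (x := fun _ => 1 / ((m : ℝ) + 1)) ⟨fun _ => by positivity, by simp; field_simp⟩
  -- An interior y may be pushed slightly away from the barycentre b; the i-th coordinate (1 + t)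
  -- y_i - t/(m+1) is still nonnegative, forcing y_i > 0.
  have hf : Tendsto (fun t : ℝ => (1 + t) • y + (-t) • b) (𝓝[>] 0) (𝓝 y) := by
    have : Continuous fun t : ℝ => (1 + t) • y + (-t) • b := by fun_prop
    simpa using (this.tendsto 0).mono_left nhdsWithin_le_nhds
  obtain ⟨t, ht, ht0⟩ := ((hf.eventually (isOpen_interior.mem_nhds hy)).and
    self_mem_nhdsWithin).exists
  have h1 := (interior_subset ht : _ ∈ simplexE m).1 i
  rw [paramE_add_smul (by ring), hb] at h1
  simp only [Pi.add_apply, Pi.smul_apply, smul_eq_mul] at h1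
  have ht0' : (0 : ℝ) < t := ht0
  have h2 : 0 < t * (1 / ((m : ℝ) + 1)) := by positivity
  nlinarith

theorem mem_interior_of_mem_openSimplex {y : EuclideanSpace ℝ (Fin m)}
    (hy : paramE y ∈ openSimplex m) : y ∈ interior (simplexE m) := by
  refine mem_interior.2 ⟨paramE ⁻¹' {x | ∀ i, 0 < x i}, fun z hz => ?_, ?_, hy.1⟩
  · exact ⟨fun i => (hz i).le, sum_paramE z⟩
  · refine IsOpen.preimage continuous_paramE ?_
    simp only [ofPred_forall]
    exact isOpen_iInter_of_finite fun i => isOpen_lt continuous_const (continuous_apply i)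

theorem ae_mem_openSimplex : ∀ᵐ x ∂(simplexVol m), x ∈ openSimplex m := by
  rw [ae_simplexVol_iff]
  have h0 := convex_simplexE (m := m).addHaar_frontier volume
  filter_upwards [ae_restrict_of_ae (compl_mem_ae_iff.2 h0),
    ae_restrict_mem isCompact_simplexE.measurableSet] with y h1 h2
  refine mem_openSimplex_of_mem_interior ?_
  by_contra h3
  exact h1 ⟨subset_closure h2, h3⟩

/-- The gradient coordinates identify the quotient with Euclidean space. -/
noncomputable def quotHomeo (m : ℕ) : Quot1 m ≃ₜ EuclideanSpace ℝ (Fin m) where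
  toFun := Quotient.lift gradE fun a b h => by
    have h1 := (Submodule.quotientRel_def _).1 h
    obtain ⟨c, hc⟩ := Submodule.mem_span_singleton.1 h1
    rw [gradE_eq_iff]
    intro i
    have h2 := congrFun hc i
    have h3 := congrFun hc 0
    simp at h2 h3
    linarith
  invFun q := proj (Fin.cons 0 (WithLp.ofLp q))
  left_inv x := by
    obtain ⟨p, rfl⟩ := Submodule.Quotient.mk_surjective _ x
    refine (Submodule.Quotient.eq _).2 (Submodule.mem_span_singleton.2 ⟨-p 0, ?_⟩)
    ext i
    change _ = (Fin.cons 0 (gradCoord p) : Fin (m + 1) → ℝ) i - p i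
    refine Fin.cases ?_ (fun i => ?_) i <;> simp [gradCoord]
  right_inv q := by
    change gradE (Fin.cons 0 (WithLp.ofLp q)) = q
    ext i
    simp [gradE, gradCoord]
  continuous_toFun := continuous_gradE.quotient_lift _
  continuous_invFun := by
    refine (continuous_quot_mk : Continuous (proj (m := m))).comp (continuous_pi fun i => ?_)
    refine Fin.cases ?_ (fun i => ?_) i
    · simpa using continuous_const
    · simp only [Fin.cons_succ]
      fun_prop

theorem continuous_proj : Continuous (proj (m := m)) := continuous_quot_mk

theorem gradE_mem_frontier {C : Set (Fin (m + 1) → ℝ)} {p : Fin (m + 1) → ℝ}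
    (hp : proj p ∈ frontier (proj '' C)) : gradE p ∈ frontier (gradE '' C) := by
  have h := mem_image_of_mem (quotHomeo m) hp
  rw [(quotHomeo m).image_frontier, image_image] at h
  exact h

theorem isCompact_graph_subgrad (hd : ∀ i, 0 < d i) (hu : ContinuousOn u (simplex m)) :
    IsCompact {q : (Fin (m + 1) → ℝ) × (Fin (m + 1) → ℝ) |
      q.1 ∈ simplex m ∧ q.2 ∈ subgrad d u q.1} := by
  have := isCompact_subgradient_graph (isCompact_stdSimplex ℝ (Fin (m + 1)))
    (isCompact_dualComplex hd) hu (b := fun x x' p => (x' - x) ⬝ᵥ p)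
    (fun x' => by unfold dotProduct; fun_prop)
  convert this using 1
  ext q
  simp only [mem_ofPred_eq, mem_prod, subgrad, and_assoc]

/-- The set is the projection of the compact graph cut by the closed condition p ∈ Z. It yields
closed walls and, with Z the complement of an open cell, open chambers. -/
theorem isClosed_exists_subgrad_mem (hd : ∀ i, 0 < d i) (hu : ContinuousOn u (simplex m))
    {Z : Set (Fin (m + 1) → ℝ)} (hZ : IsClosed Z) :
    IsClosed {x | x ∈ simplex m ∧ ∃ p ∈ subgrad d u x, p ∈ Z} := by
  have h := ((isCompact_graph_subgrad hd hu).inter_right (hZ.preimage continuous_snd)).image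
    continuous_fst
  convert h.isClosed using 1
  ext x
  constructor
  · rintro ⟨hx, p, hp, hpZ⟩
    exact ⟨(x, p), ⟨⟨hx, hp⟩, hpZ⟩, rfl⟩
  · rintro ⟨q, ⟨⟨hx, hp⟩, hpZ⟩, rfl⟩
    exact ⟨hx, q.2, hp, hpZ⟩

theorem isClosed_wallSet (hd : ∀ i, 0 < d i) (hu : ContinuousOn u (simplex m)) :
    IsClosed (wallSet d u) := by
  have hZ : IsClosed {p : Fin (m + 1) → ℝ | ∃ k, proj p ∈ frontier (dualCellBar d k)} := by
    simp only [ofPred_exists]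
    exact isClosed_iUnion_of_finite fun k => isClosed_frontier.preimage continuous_proj
  exact isClosed_exists_subgrad_mem hd hu hZ

theorem isOpen_chamber (hd : ∀ i, 0 < d i) (hu : ContinuousOn u (simplex m)) (k : Fin (m + 1)) :
    IsOpen {x : Hyperplane m | (x : Fin (m + 1) → ℝ) ∈ chamber d u k} := by
  have hZ := (isClosed_exists_subgrad_mem hd hu (Z := (proj ⁻¹' interior (dualCellBar d k))ᶜ)
    (isOpen_interior.preimage continuous_proj).isClosed_compl).isOpen_compl
  have hO : IsOpen {x : Fin (m + 1) → ℝ | ∀ i, 0 < x i} := by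
    simp only [ofPred_forall]
    exact isOpen_iInter_of_finite fun i => isOpen_lt continuous_const (continuous_apply i)
  convert (hO.inter hZ).preimage (continuous_subtype_val (p := fun x => ∑ i, x i = 1)) using 1
  ext x
  constructor
  · rintro ⟨h1, h2⟩
    exact ⟨h1.1, fun ⟨_, p, hp, hpZ⟩ => hpZ (h2 p hp)⟩
  · rintro ⟨h1, h2⟩
    refine ⟨⟨h1, x.2⟩, fun p hp => ?_⟩
    by_contra h3
    exact h2 ⟨⟨fun i => (h1 i).le, x.2⟩, p, hp, h3⟩

/-- In gradient coordinates the cell is convex, so its frontier is Lebesgue-null, and the target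
measure has a density. -/
theorem weightedDualVol_wall (hd : ∀ i, 0 < d i) (n : ℕ) (k : Fin (m + 1)) :
    weightedDualVol d n (proj ⁻¹' frontier (dualCellBar d k)) = 0 := by
  have hc : Convex ℝ (gradE '' dualCell d k) := by
    have : IsLinearMap ℝ (gradE (m := m)) :=
      ⟨fun x y => by ext i; simp [gradE, gradCoord]; ring,
        fun c x => by ext i; simp [gradE, gradCoord]; ring⟩
    exact (convex_dualCell k).is_linear_image this
  have h0 : (weightedDualVol d n).map gradE (frontier (gradE '' dualCell d k)) = 0 := by
    rw [map_gradE_weightedDualVol hd]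
    exact withDensity_absolutelyContinuous _ _ (hc.addHaar_frontier volume)
  rw [Measure.map_apply measurable_gradE isClosed_frontier.measurableSet] at h0
  exact measure_mono_null (fun p hp => gradE_mem_frontier hp) h0

end

/-! ### Transfer to the transport potential. -/

section

open scoped RealInnerProductSpace

variable {m : ℕ} {d : Fin (m + 1) → ℕ} {n : ℕ} {u : (Fin (m + 1) → ℝ) → ℝ}

/-- A second order expansion in Euclidean space, in matrix form. -/
theorem exists_matrix_hasAlexandrovHessian {y : EuclideanSpace ℝ (Fin m)} {p : Fin (m + 1) → ℝ}
    {A : EuclideanSpace ℝ (Fin m) →L[ℝ] EuclideanSpace ℝ (Fin m)}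
    (hA : (A : EuclideanSpace ℝ (Fin m) →ₗ[ℝ] EuclideanSpace ℝ (Fin m)).IsSymmetric)
    (h : (fun w => (u ∘ paramE) (y + w) - (u ∘ paramE) y - ⟪gradE p, w⟫ - ⟪A w, w⟫ / 2)
      =o[𝓝 0] fun w => ‖w‖ ^ 2) :
    ∃ M : Matrix (Fin m) (Fin m) ℝ, M.det = A.det ∧
      HasAlexandrovHessian u (paramE y) (gradCoord p) M := by
  set M : Matrix (Fin m) (Fin m) ℝ := Matrix.toEuclideanLin.symm
    (A : EuclideanSpace ℝ (Fin m) →ₗ[ℝ] EuclideanSpace ℝ (Fin m))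
  have hM : Matrix.toEuclideanLin M =
      (A : EuclideanSpace ℝ (Fin m) →ₗ[ℝ] EuclideanSpace ℝ (Fin m)) :=
    LinearEquiv.apply_symm_apply _ _
  refine ⟨M, ?_, ?_, ?_⟩
  · rw [ContinuousLinearMap.det, ← hM, Matrix.toEuclideanLin_eq_toLin_orthonormal, LinearMap.det_toLin]
  · have : M.IsHermitian := Matrix.isSymmetric_toEuclideanLin_iff.1 (hM ▸ hA)
    rwa [Matrix.IsHermitian, Matrix.conjTranspose_eq_transpose_of_trivial] at this
  · have hcont : Continuous fun w : Fin m → ℝ => WithLp.toLp 2 w := PiLp.continuous_toLp 2 _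
    have hlim : Tendsto (fun w : Fin m → ℝ => WithLp.toLp 2 w) (𝓝 0)
        (𝓝 (0 : EuclideanSpace ℝ (Fin m))) := by
      simpa using hcont.tendsto 0
    -- `HasAlexandrovHessian` measures the remainder in the sup norm, the expansion in the Euclidean
    -- one; the two are comparable.
    have hO : (fun w : Fin m → ℝ => ‖WithLp.toLp 2 w‖ ^ 2) =O[𝓝 0] fun w => ‖w‖ ^ 2 := by
      refine IsBigO.pow ?_ 2
      refine IsBigO.norm_left (IsBigO.norm_right ?_)
      exact ((PiLp.continuousLinearEquiv 2 ℝ (fun _ : Fin m => ℝ)).symm :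
        (Fin m → ℝ) →L[ℝ] EuclideanSpace ℝ (Fin m)).isBigO_id _
    refine ((h.comp_tendsto hlim).trans_isBigO hO).congr_left fun w => ?_
    have hAw : A (WithLp.toLp 2 w) = WithLp.toLp 2 (M *ᵥ w) :=
      (LinearMap.congr_fun hM (WithLp.toLp 2 w)).symm
    simp only [Function.comp_apply, hAw, tail_paramE, gradE,
      EuclideanSpace.inner_eq_star_dotProduct, star_trivial]
    rw [dotProduct_comm w (gradCoord p)]
    simp only [paramE, WithLp.ofLp_add]
    ring

theorem smul_simplexVol_eq :
    ENNReal.ofReal (constC1 d n / (simplexVol m univ).toReal) • simplexVol m =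
      ENNReal.ofReal (constC1 d n) • normalizedVol m := by
  rw [normalizedVol, smul_smul, ENNReal.ofReal_div_of_pos, ENNReal.ofReal_toReal, div_eq_mul_inv]
  · rw [simplexVol_univ]; simp
  · rw [simplexVol_univ, ENNReal.toReal_ofReal (by positivity)]; positivity

theorem density_const_pos (hd : ∀ i, 0 < d i) (hmn : m ≤ n) : 0 < constC1 d n / (simplexVol m univ).toReal := by
  have := constC1_pos hd hmn
  rw [simplexVol_univ, ENNReal.toReal_ofReal (by positivity)]
  positivity

variable (hd : ∀ i, 0 < d i) (hmn : m ≤ n) (hu : IsTransportPotential d n u)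
include hd hmn hu

/-- The optimal map, with its properties almost everywhere for Lebesgue measure on the simplex. -/
theorem exists_isSubgradientTransport : ∃ T : (Fin (m + 1) → ℝ) → (Fin (m + 1) → ℝ),
    IsSubgradientTransport volume (simplexE m) (u ∘ paramE) (densityE d n)
      (ENNReal.ofReal (constC1 d n / (simplexVol m univ).toReal)) (gradE ∘ T ∘ paramE) ∧
    (∀ᵐ x ∂(simplexVol m), subgrad d u x = {T x}) ∧
    ∀ A : Set (Fin (m + 1) → ℝ), weightedDualVol d n A = 0 → ∀ᵐ x ∂(simplexVol m), T x ∉ A := by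
  obtain ⟨T, hT, hTsub⟩ := hu.exists_map
  have hc := density_const_pos hd hmn
  have hc0 : ENNReal.ofReal (constC1 d n / (simplexVol m univ).toReal) ≠ 0 := by simpa using hc
  have hmap : (ENNReal.ofReal (constC1 d n / (simplexVol m univ).toReal) • simplexVol m).map T =
      weightedDualVol d n := by
    rw [smul_simplexVol_eq, hT.map_eq]
  rw [ae_normalizedVol_iff] at hTsub
  refine ⟨T, ⟨isCompact_simplexE, simplexE_nonempty, convexOn_comp_paramE hu.convexOn,
    hu.continuousOn.comp continuous_paramE.continuousOn fun y hy => hy, hc0,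
    measurable_densityE hd n,
    measurable_gradE.comp (hT.measurable.comp continuous_paramE.measurable), ?_, ?_⟩, hTsub, ?_⟩
  · rw [← map_gradE_weightedDualVol hd, ← hmap, simplexVol_eq_map, ← Measure.map_smul,
      Measure.map_map hT.measurable continuous_paramE.measurable,
      Measure.map_map measurable_gradE (hT.measurable.comp continuous_paramE.measurable)]
  · filter_upwards [ae_simplexVol_iff.1 hTsub] with y hy
    exact (mem_subgrad_paramE.1 (hy.symm.subset rfl)).2
  · intro A hA
    rw [← hmap] at hA
    have := (Measure.ae_ennreal_smul_measure_iff hc0).1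
      (ae_of_ae_map hT.measurable.aemeasurable (compl_mem_ae_iff.2 hA))
    exact this

/-- At almost every x the only subgradient T x lies in some closed cell and on no cell boundary,
hence in the interior of that cell. -/
theorem ae_mem_chamber : ∀ᵐ x ∂(simplexVol m), x ∉ wallSet d u ∧ ∃ k, x ∈ chamber d u k := by
  obtain ⟨T, -, hsub, hnull⟩ := exists_isSubgradientTransport hd hmn hu
  filter_upwards [hsub, hnull (⋃ k, proj ⁻¹' frontier (dualCellBar d k))
    (measure_iUnion_null fun k => weightedDualVol_wall hd n k), ae_mem_openSimplex] with x h1 h2 h3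
  have h2' : ∀ k, proj (T x) ∉ frontier (dualCellBar d k) := fun k hk =>
    h2 (mem_iUnion.2 ⟨k, hk⟩)
  constructor
  · rintro ⟨-, p, hp, k, hk⟩
    rw [h1, mem_singleton_iff] at hp
    exact h2' k (hp ▸ hk)
  · have hT : T x ∈ subgrad d u x := h1.symm.subset rfl
    obtain ⟨k, hk⟩ := mem_iUnion.1 hT.1
    refine ⟨k, h3, fun p hp => ?_⟩
    rw [h1, mem_singleton_iff] at hp
    subst hp
    by_contra hi
    exact h2' k ⟨subset_closure (mem_image_of_mem _ hk), hi⟩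

/-- The mass balance ignores the walls: it holds for every Borel subset of the simplex, and the
chambers are a special case. -/
theorem realMA_eq {A : Set (Fin (m + 1) → ℝ)} (hA : MeasurableSet A) (hAs : A ⊆ simplex m) :
    realMA d n u A =
      ENNReal.ofReal (constC1 d n / (simplexVol m univ).toReal) * simplexVol m A := by
  obtain ⟨T, hT, -, -⟩ := exists_isSubgradientTransport hd hmn hu
  have hA' : MeasurableSet (paramE ⁻¹' A) := continuous_paramE.measurable hA
  have hsub : paramE ⁻¹' A ⊆ simplexE m := preimage_mono hAs
  have hKm := ((isCompact_dualComplex hd).image continuous_gradE).measurableSet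
  have hK : volume.withDensity (densityE d n) (gradE '' dualComplex d)ᶜ = 0 := by
    rw [withDensity_apply _ hKm.compl, densityE, setLIntegral_indicator hKm, inter_compl_self,
      Measure.restrict_empty, lintegral_zero_measure]
  obtain ⟨h1, h2⟩ := hT.withDensity_iUnion_subdiff hK hA' hsub
  rw [← map_gradE_weightedDualVol hd] at h1 h2
  rw [Measure.map_apply₀ measurable_gradE.aemeasurable h1] at h2
  have hvol : simplexVol m A = volume (paramE ⁻¹' A) := by
    rw [simplexVol_eq_map, Measure.map_apply continuous_paramE.measurable hA,
      Measure.restrict_apply hA', inter_eq_self_of_subset_left hsub]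
  rw [realMA, hvol, ← h2]
  refine measure_congr (eventuallyEq_set.2 ?_)
  filter_upwards [(withDensity_absolutelyContinuous (dualVol d) _).ae_le
    (ae_mem_dualComplex hd)] with p hp
  simp only [mem_iUnion, mem_preimage, exists_prop, mem_inter_iff]
  constructor
  · rintro ⟨x, hx, hpx⟩
    obtain ⟨y, -, rfl⟩ := exists_paramE_of_mem_simplex (hAs hx)
    exact ⟨y, hx, (mem_subgrad_paramE.1 hpx).2, mem_image_of_mem _ hp⟩
  · rintro ⟨y, hy, hpy, -⟩
    exact ⟨paramE y, hy, mem_subgrad_paramE.2 ⟨hp, hpy⟩⟩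

theorem ae_exists_hessian : ∀ᵐ x ∂(simplexVol m), x ∈ openSimplex m →
    ∃ (p : Fin (m + 1) → ℝ) (A : Matrix (Fin m) (Fin m) ℝ),
      subgrad d u x = {p} ∧ HasAlexandrovHessian u x (gradCoord p) A ∧
      A.det * weight d n p = constC1 d n / (simplexVol m univ).toReal := by
  obtain ⟨T, hT, hsub, -⟩ := exists_isSubgradientTransport hd hmn hu
  rw [ae_simplexVol_iff] at hsub ⊢
  have hmem : ∀ᵐ y ∂(volume.restrict (simplexE m)), T (paramE y) ∈ dualComplex d := by
    filter_upwards [hsub] with y hy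
    exact (hy.symm.subset rfl : T (paramE y) ∈ subgrad d u (paramE y)).1
  filter_upwards [hsub, hmem, hT.ae_mongeAmpere ((isCompact_dualComplex hd).image continuous_gradE)
    (hmem.mono fun y hy => mem_image_of_mem _ hy)] with y h1 h2 h3 hy
  obtain ⟨A, hA, hexp, hdet, heq⟩ := h3 (mem_interior_of_mem_openSimplex hy)
  obtain ⟨M, hM, hMA⟩ := exists_matrix_hasAlexandrovHessian (p := T (paramE y)) hA hexp
  refine ⟨T (paramE y), M, h1, hMA, ?_⟩
  rw [Function.comp_apply, Function.comp_apply, densityE_gradE n h2,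
    ← ENNReal.ofReal_mul hdet] at heq
  rw [hM]
  exact (ENNReal.ofReal_eq_ofReal_iff (mul_nonneg hdet (weight_nonneg n h2))
    (density_const_pos hd hmn).le).1 heq

end
end WallChamber

open WallChamber
theorem mainTheorem8 (m n : ℕ) (hm : 1 ≤ m) (hmn : m + 1 ≤ n)
    (d : Fin (m + 1) → ℕ) (hd : ∀ i, 0 < d i)
    (u : (Fin (m + 1) → ℝ) → ℝ) (hu : IsTransportPotential d n u) :
    -- the wall set is closed and Lebesgue-null
    (IsClosed (wallSet d u) ∧ simplexVol m (wallSet d u) = 0) ∧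
    -- the chambers are open and together have full measure
    ((∀ k, IsOpen {x : Hyperplane m | (x : Fin (m + 1) → ℝ) ∈ chamber d u k}) ∧
      simplexVol m (simplex m \ ⋃ k, chamber d u k) = 0) ∧
    -- the value of the constant
    constC1 d n / (simplexVol m univ).toReal =
      (∑ i, (d i : ℝ)) / (∏ i, (d i : ℝ)) *
        (((n - m).factorial : ℝ) * (m.factorial : ℝ) / (n.factorial : ℝ)) ∧
    -- the equation on each chamber: in the weak sense, and pointwise almost everywhere
    ∀ k,
      (∀ E : Set (Fin (m + 1) → ℝ), MeasurableSet E → E ⊆ chamber d u k →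
        realMA d n u E =
          ENNReal.ofReal (constC1 d n / (simplexVol m univ).toReal) * simplexVol m E) ∧
      (∀ᵐ x ∂(simplexVol m), x ∈ chamber d u k →
        ∃ (p : Fin (m + 1) → ℝ) (A : Matrix (Fin m) (Fin m) ℝ),
          subgrad d u x = {p} ∧ HasAlexandrovHessian u x (gradCoord p) A ∧
          A.det * weight d n p = constC1 d n / (simplexVol m univ).toReal) := by
  have hmn' : m ≤ n := by omega
  have hsub : ∀ k, chamber d u k ⊆ openSimplex m := fun k x hx => hx.1
  have hae := ae_mem_chamber hd hmn' hu
  refine ⟨⟨isClosed_wallSet hd hu.continuousOn, ?_⟩, ⟨isOpen_chamber hd hu.continuousOn, ?_⟩,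
    constC1_div_simplexVol hd hmn', fun k => ⟨fun E hE hEk => ?_, ?_⟩⟩
  · exact compl_mem_ae_iff.1 (hae.mono fun x hx => hx.1)
  · refine compl_mem_ae_iff.1 (hae.mono fun x hx => ?_)
    exact fun h => h.2 (mem_iUnion.2 hx.2)
  · exact realMA_eq hd hmn' hu hE fun x hx => ⟨fun i => ((hEk hx).1.1 i).le, (hEk hx).1.2⟩
  · filter_upwards [ae_exists_hessian hd hmn' hu] with x hx hxk
    exact hx hxk.1
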